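/- Let $\pi:Y\to X$ be a smooth fiber bundle over a finite-dimensional smooth manifold $X$ (manifolds are Hausdorff and second countable), $E\to X$ a smooth real vector bundle of finite rank, and $\mathcal E$ an $E$-valued differential operator on $Y$, i.e. a smooth bundle morphism $J^kY\to E$ over $X$ for some $k$. Let $\mathcal O_\infty Y$ be the ring of smooth functions on the finite order jet manifolds $J^rY$ modulo pull-back. For a vector bundle $V\to X$ let $M_V$ be the $\mathcal O_\infty Y$-module of smooth functions on the finite order jet manifolds of $Y\times_XV$ that are linear in the jets of $V$, modulo pull-back; locally it is generated by the jets $c_\Lambda$ of the fiber coordinates of $V$. Let $\mathcal S_\infty[E;Y]=\bigwedge_{\mathcal O_\infty Y}M_E$, with the generators $c^a_\Lambda$ odd of antifield number $1$ and with the right graded derivation $\delta$ that is $\mathcal O_\infty Y$-linear and satisfies $\delta c^a_\Lambda=d_\Lambda\mathcal E^a$, where $d_\Lambda$ are total derivatives; $\delta\circ\delta=0$. Let $H_1(\delta)$ be the first homology of the complex $$0\leftarrow \mathrm{Im}\,\delta\xleftarrow{\ \delta\ }\mathcal S_\infty[E;Y]_1\xleftarrow{\ \delta\ }\mathcal S_\infty[E;Y]_2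 .$$ Suppose that $H_1(\delta)$ is finitely generated in the following sense: there are a $C^\infty(X)$-submodule $\mathcal C_{(0)}\subset H_1(\delta)$ that is projective of finite (constant) rank, and a $C^\infty(X)$-linear choice of representatives of its elements by one-cycles, such that every one-cycle is, up to a $\delta$-boundary, a finite sum of elements $\sum_\Xi G^\Xi d_\Xi\Delta$ with $G^\Xi\in\mathcal O_\infty Y$ and $\Delta$ the representative of an element of $\mathcal C_{(0)}$. Then there are a smooth vector bundle $E_0\to X$ and a tuple $\Delta=(\Delta^r)$, $\Delta^r=\sum_\Lambda\Delta^{\Lambda r}_ac^a_\Lambda$ (globally, a section of $E_0$ with coefficients in $M_E$, the $\Delta^r$ being its components in local frames), such that all components of $\Delta$ along sections of $E_0^*$ are one-cycles and sending a section of $E_0^*$ to the class of the component of $\Delta$ along it is an isomorphism of $C^\infty(X)$-modules from the sections of $E_0^*$ onto $\mathcal C_{(0)}$, and such that the following holds. Let $\mathcal P_\infty[E;Y;E_0]=\bigwedge_{\mathcal O_\infty Y}M_E\otimes_{\mathcal O_\infty Y}\mathrm{Sym}_{\mathcal O_\infty Y}M_{E_0}$, where the generators $c^r_\Xi$ of $M_{E_0}$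 are even of antifield number $2$; it contains $\mathcal S_\infty[E;Y]$, compatibly with antifield numbers, and has the same elements of antifield number $1$. 1. For every tuple $\Delta'=(\Delta'^r)$ of the same kind as $\Delta$ (whether or not it consists of cycles), there is exactly one $\mathcal O_\infty Y$-linear map $\delta_{\Delta'}$ of $\mathcal P_\infty[E;Y;E_0]$ with $\delta_{\Delta'}(ff')=(-1)^{[f']}\delta_{\Delta'}(f)f'+f\delta_{\Delta'}(f')$, $\delta_{\Delta'}c^a_\Lambda=d_\Lambda\mathcal E^a$ and $\delta_{\Delta'}c^r_\Xi=d_\Xi\Delta'^r$, that is, $\delta_{\Delta'}=\delta+\overleftarrow{\partial}_r\Delta'^r$; it is nilpotent, $\delta_{\Delta'}\circ\delta_{\Delta'}=0$, if and only if the Noether identities $\sum_\Lambda\Delta'^{\Lambda r}_a\,d_\Lambda\mathcal E^a=0$ hold. 2. $\delta_0=\delta_{\Delta}$ is nilpotent, restricts to $\delta$ on $\mathcal S_\infty[E;Y]$, and $$0\leftarrow \mathrm{Im}\,\delta\xleftarrow{\ \delta\ }\mathcal S_\infty[E;Y]_1\xleftarrow{\ \delta_0\ }\mathcal P_\infty[E;Y;E_0]_2\xleftarrow{\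 \delta_0\ }\mathcal P_\infty[E;Y;E_0]_3$$ (subscripts are antifield numbers) is a chain complex whose homology is trivial in degrees $0$ and $1$. -/

import Mathlib

set_option linter.unusedSectionVars false

open Bundle Set Filter Topology Manifold
open scoped ContDiff Manifold Bundle TensorProduct

noncomputable section
namespace NoetherKT

section Jets

variable {EX : Type*} [NormedAddCommGroup EX] [NormedSpace ℝ EX]
  {EZ : Type*} [NormedAddCommGroup EZ] [NormedSpace ℝ EZ]
  {V : Type*} [NormedAddCommGroup V] [NormedSpace ℝ V]

/-- Coordinate space of `r`-jets at points of `EX` of maps `EX → EZ`: the point and all derivatives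
of order at most `r`. -/
abbrev JetSpace (EX EZ : Type*) [NormedAddCommGroup EX] [NormedSpace ℝ EX]
    [NormedAddCommGroup EZ] [NormedSpace ℝ EZ] (r : ℕ) : Type _ :=
  EX × (∀ k : Fin (r + 1), EX [×(k : ℕ)]→L[ℝ] EZ)

/-- The `r`-jet of a map between normed spaces at a point. -/
def jet (r : ℕ) (v : EX → EZ) (u : EX) : JetSpace EX EZ r :=
  (u, fun k => iteratedFDeriv ℝ (k : ℕ) v u)

/-- Forgetting the derivatives of order greater than `r`. -/
def trunc {r r' : ℕ} (h : r ≤ r') : JetSpace EX EZ r' →L[ℝ] JetSpace EX EZ r :=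
  (ContinuousLinearMap.fst ℝ EX _).prod
    (ContinuousLinearMap.pi fun k : Fin (r + 1) =>
      (ContinuousLinearMap.proj (R := ℝ) (φ := fun k : Fin (r' + 1) => EX [×(k : ℕ)]→L[ℝ] EZ)
        (Fin.castLE (Nat.succ_le_succ h) k)).comp (ContinuousLinearMap.snd ℝ EX _))

theorem trunc_jet {r r' : ℕ} (h : r ≤ r') (v : EX → EZ) (u : EX) :
    trunc h (jet r' v u) = jet r v u := rfl

theorem jet_congr {r : ℕ} {v w : EX → EZ} {u : EX} (h : v =ᶠ[𝓝 u] w) : jet r v u = jet r w u := by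
  unfold jet
  ext1
  · rfl
  · funext k
    exact (h.iteratedFDeriv ℝ (k : ℕ)).eq_of_nhds

theorem contDiffAt_jet {r : ℕ} {v : EX → EZ} {u : EX} (h : ContDiffAt ℝ ∞ v u) :
    ContDiffAt ℝ ∞ (jet r v) u := by
  unfold jet
  refine contDiffAt_id.prodMk (contDiffAt_pi.2 fun k => ?_)
  exact h.iteratedFDeriv_right (m := ∞) (i := (k : ℕ)) le_rfl

/-- The derivative of `jet r v` is read off from `jet (r + 1) v`. -/
def jetShift (r : ℕ) : JetSpace EX EZ (r + 1) → (EX →L[ℝ] JetSpace EX EZ r) := fun p =>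
  (ContinuousLinearMap.id ℝ EX).prod
    (ContinuousLinearMap.pi fun k : Fin (r + 1) =>
      continuousMultilinearCurryLeftEquiv ℝ (fun _ : Fin ((k : ℕ) + 1) => EX) EZ (p.2 k.succ))

theorem contDiff_jetShift [FiniteDimensional ℝ EX] (r : ℕ) :
    ContDiff ℝ ∞ (jetShift (EX := EX) (EZ := EZ) r) := by
  rw [contDiff_clm_apply_iff]
  intro e
  refine contDiff_const.prodMk (contDiff_pi.2 fun k => ?_)
  have h1 : ContDiff ℝ ∞ fun p : JetSpace EX EZ (r + 1) =>
      continuousMultilinearCurryLeftEquiv ℝ (fun _ : Fin ((k : ℕ) + 1) => EX) EZ (p.2 k.succ) :=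
    (LinearIsometryEquiv.contDiff _).comp
      ((ContinuousLinearMap.proj (R := ℝ) (φ := fun k : Fin (r + 1 + 1) => EX [×(k : ℕ)]→L[ℝ] EZ)
        k.succ).contDiff.comp contDiff_snd)
  exact h1.clm_apply contDiff_const

theorem hasFDerivAt_jet {r : ℕ} {v : EX → EZ} {u : EX} (h : ContDiffAt ℝ ∞ v u) :
    HasFDerivAt (jet r v) (jetShift r (jet (r + 1) v u)) u := by
  unfold jet jetShift
  refine (hasFDerivAt_id u).prodMk (hasFDerivAt_pi.2 fun k => ?_)
  have h1 : DifferentiableAt ℝ (iteratedFDeriv ℝ (k : ℕ) v) u :=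
    (h.iteratedFDeriv_right (m := ∞) (i := (k : ℕ)) le_rfl).differentiableAt (by simp)
  have h2 := h1.hasFDerivAt
  have h3 : continuousMultilinearCurryLeftEquiv ℝ (fun _ : Fin ((k : ℕ) + 1) => EX) EZ
      (iteratedFDeriv ℝ ((k : ℕ) + 1) v u) = fderiv ℝ (iteratedFDeriv ℝ (k : ℕ) v) u := by
    rw [iteratedFDeriv_succ_eq_comp_left, Function.comp_apply, LinearIsometryEquiv.apply_symm_apply]
  rw [← h3] at h2
  exact h2

/-- Iterated derivatives of a smooth function of the `k`-jet of `v` are smooth functions of jets of `v`. -/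
theorem exists_prolong [FiniteDimensional ℝ EX] {k : ℕ} {G : JetSpace EX EZ k → V} {W : Set (JetSpace EX EZ k)}
    (hW : IsOpen W) (hG : ContDiffOn ℝ ∞ G W) (j : ℕ) :
    ∃ Gj : JetSpace EX EZ (k + j) → (EX [×j]→L[ℝ] V),
      ContDiffOn ℝ ∞ Gj (trunc (Nat.le_add_right k j) ⁻¹' W) ∧
      ∀ (v : EX → EZ) (u : EX), (∀ᶠ u' in 𝓝 u, ContDiffAt ℝ ∞ v u') → jet k v u ∈ W →
        iteratedFDeriv ℝ j (fun u' => G (jet k v u')) u = Gj (jet (k + j) v u) := by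
  induction j with
  | zero =>
    refine ⟨fun p => (continuousMultilinearCurryFin0 ℝ EX V).symm (G p), ?_, ?_⟩
    · exact (LinearIsometryEquiv.contDiff _).comp_contDiffOn hG
    · intro v u _ _
      rfl
  | succ j ih =>
    obtain ⟨Gj, hGj, hj⟩ := ih
    set Wj : Set (JetSpace EX EZ (k + j)) := trunc (Nat.le_add_right k j) ⁻¹' W with hWj
    have hWjo : IsOpen Wj := hW.preimage (trunc _).continuous
    refine ⟨fun p => (continuousMultilinearCurryLeftEquiv ℝ (fun _ : Fin (j + 1) => EX) V).symm
      ((fderiv ℝ Gj (trunc (Nat.le_succ _) p)).comp (jetShift (k + j) p)), ?_, ?_⟩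
    · refine ContDiff.comp_contDiffOn (g := fun q : EX →L[ℝ] (EX [×j]→L[ℝ] V) =>
        (continuousMultilinearCurryLeftEquiv ℝ (fun _ : Fin (j + 1) => EX) V).symm q)
        (LinearIsometryEquiv.contDiff _) ?_
      refine ContDiffOn.clm_comp ?_ (contDiff_jetShift _).contDiffOn
      exact (hGj.fderiv_of_isOpen hWjo (m := ∞) (by simp)).comp
        (trunc (EX := EX) (EZ := EZ) (Nat.le_succ (k + j))).contDiff.contDiffOn (fun p hp => hp)
    · intro v u hv hu
      have hcont : ContinuousAt (jet k v) u := (contDiffAt_jet hv.self_of_nhds).continuousAt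
      have hev : iteratedFDeriv ℝ j (fun u' => G (jet k v u'))
          =ᶠ[𝓝 u] fun u' => Gj (jet (k + j) v u') := by
        filter_upwards [hv.eventually_nhds, hcont.eventually_mem (hW.mem_nhds hu)] with u' h1 h2
        exact hj v u' h1 h2
      have hd : HasFDerivAt Gj (fderiv ℝ Gj (jet (k + j) v u)) (jet (k + j) v u) :=
        ((hGj.contDiffAt (hWjo.mem_nhds hu)).differentiableAt (by simp)).hasFDerivAt
      have hc := hd.comp u (hasFDerivAt_jet (r := k + j) hv.self_of_nhds)
      rw [iteratedFDeriv_succ_eq_comp_left, Function.comp_apply, hev.fderiv_eq]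
      congr 1
      exact hc.fderiv

end Jets

section JetSmooth

variable {EX : Type*} [NormedAddCommGroup EX] [NormedSpace ℝ EX]
  {X : Type*} [TopologicalSpace X] [ChartedSpace EX X]
  {EZ : Type*} [NormedAddCommGroup EZ] [NormedSpace ℝ EZ] {HZ : Type*} [TopologicalSpace HZ]
  {JZ : ModelWithCorners ℝ EZ HZ} {Z : Type*} [TopologicalSpace Z] [ChartedSpace HZ Z]
  {EQ : Type*} [NormedAddCommGroup EQ] [NormedSpace ℝ EQ] {HQ : Type*} [TopologicalSpace HQ]
  {JQ : ModelWithCorners ℝ EQ HQ} {Q : Type*} [TopologicalSpace Q] [ChartedSpace HQ Q]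
  {EQ' : Type*} [NormedAddCommGroup EQ'] [NormedSpace ℝ EQ'] {HQ' : Type*} [TopologicalSpace HQ']
  {JQ' : ModelWithCorners ℝ EQ' HQ'} {Q' : Type*} [TopologicalSpace Q'] [ChartedSpace HQ' Q']
  {ι κ : Type*}

/-- Coordinates of the `r`-jet of `S : X → Z` at `x`, in the charts of `X` and `Z` centred at `x₀`
and `z₀`: the coordinates of `x` and all partial derivatives of order at most `r` of the
coordinate expression of `S`. -/
def jetCoord (JZ : ModelWithCorners ℝ EZ HZ) (r : ℕ) (x₀ : X) (z₀ : Z) (x : X) (S : X → Z) :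
    JetSpace EX EZ r :=
  jet r (extChartAt JZ z₀ ∘ S ∘ (extChartAt 𝓘(ℝ, EX) x₀).symm) (extChartAt 𝓘(ℝ, EX) x₀ x)

/-- Let `ι` be a family of jets of maps `X → Z`, the jet `i` being that of `map i` at `base i`.
`f : ι → Q` is a smooth function of finite order if for some `r` it is, near every member of the
family, a smooth function of the jet coordinates of order at most `r`. In particular `f i` depends
on nothing but the `r`-jet of `map i` at `base i`. For the jets of local sections of a bundle
`Z → X` these are the smooth maps to `Q` on the jet manifold of order `r` (a submanifold
of the manifold of `r`-jets of maps `X → Z`), for all `r` together. -/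
def JetSmooth (EX : Type*) [NormedAddCommGroup EX] [NormedSpace ℝ EX]
    {X : Type*} [TopologicalSpace X] [ChartedSpace EX X]
    {ι : Type*} (JZ : ModelWithCorners ℝ EZ HZ) (JQ : ModelWithCorners ℝ EQ HQ)
    (base : ι → X) (map : ι → X → Z) (f : ι → Q) : Prop :=
  ∃ r : ℕ, ∀ i₀ : ι, ∃ (W : Set (JetSpace EX EZ r)) (g : JetSpace EX EZ r → Q),
    IsOpen W ∧ ContMDiffOn 𝓘(ℝ, JetSpace EX EZ r) JQ ∞ g W ∧
    jetCoord JZ r (base i₀) (map i₀ (base i₀)) (base i₀) (map i₀) ∈ W ∧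
    ∀ i : ι, base i ∈ (extChartAt 𝓘(ℝ, EX) (base i₀)).source →
      map i (base i) ∈ (extChartAt JZ (map i₀ (base i₀))).source →
      jetCoord JZ r (base i₀) (map i₀ (base i₀)) (base i) (map i) ∈ W →
      f i = g (jetCoord JZ r (base i₀) (map i₀ (base i₀)) (base i) (map i))

variable {base : ι → X} {map : ι → X → Z}

theorem JetSmooth.comp_contMDiff {f : ι → Q} (hf : JetSmooth EX JZ JQ base map f) {h : Q → Q'}
    (hh : ContMDiff JQ JQ' ∞ h) : JetSmooth EX JZ JQ' base map (fun i => h (f i)) := by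
  obtain ⟨r, hr⟩ := hf
  refine ⟨r, fun i₀ => ?_⟩
  obtain ⟨W, g, hW, hg, h0, hi⟩ := hr i₀
  exact ⟨W, h ∘ g, hW, hh.comp_contMDiffOn hg, h0, fun i h1 h2 h3 => by
    exact congrArg h (hi i h1 h2 h3)⟩

theorem JetSmooth.prodMk {f : ι → Q} {f' : ι → Q'} (hf : JetSmooth EX JZ JQ base map f)
    (hf' : JetSmooth EX JZ JQ' base map f') :
    JetSmooth EX JZ (JQ.prod JQ') base map (fun i => (f i, f' i)) := by
  obtain ⟨r, hr⟩ := hf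
  obtain ⟨r', hr'⟩ := hf'
  refine ⟨max r r', fun i₀ => ?_⟩
  obtain ⟨W, g, hW, hg, h0, hi⟩ := hr i₀
  obtain ⟨W', g', hW', hg', h0', hi'⟩ := hr' i₀
  refine ⟨trunc (le_max_left r r') ⁻¹' W ∩ trunc (le_max_right r r') ⁻¹' W',
    fun p => (g (trunc (le_max_left r r') p), g' (trunc (le_max_right r r') p)),
    (hW.preimage (trunc _).continuous).inter (hW'.preimage (trunc _).continuous),
    ContMDiffOn.prodMk ?_ ?_, ⟨h0, h0'⟩, fun i h1 h2 h3 => ?_⟩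
  · exact hg.comp (trunc (EX := EX) (EZ := EZ) (le_max_left r r')).contMDiff.contMDiffOn fun p hp => hp.1
  · exact hg'.comp (trunc (EX := EX) (EZ := EZ) (le_max_right r r')).contMDiff.contMDiffOn fun p hp => hp.2
  · exact Prod.ext (hi i h1 h2 h3.1) (hi' i h1 h2 h3.2)

theorem JetSmooth.add {f g : ι → ℝ} (hf : JetSmooth EX JZ 𝓘(ℝ, ℝ) base map f)
    (hg : JetSmooth EX JZ 𝓘(ℝ, ℝ) base map g) :
    JetSmooth EX JZ 𝓘(ℝ, ℝ) base map (f + g) := by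
  refine JetSmooth.comp_contMDiff (hf.prodMk hg) (h := fun q : ℝ × ℝ => q.1 + q.2) ?_
  exact contMDiff_fst.add contMDiff_snd

theorem JetSmooth.mul {f g : ι → ℝ} (hf : JetSmooth EX JZ 𝓘(ℝ, ℝ) base map f)
    (hg : JetSmooth EX JZ 𝓘(ℝ, ℝ) base map g) :
    JetSmooth EX JZ 𝓘(ℝ, ℝ) base map (f * g) := by
  refine JetSmooth.comp_contMDiff (hf.prodMk hg) (h := fun q : ℝ × ℝ => q.1 * q.2) ?_
  exact contMDiff_fst.mul contMDiff_snd

theorem jetSmooth_const (q : Q) : JetSmooth EX JZ JQ base map (fun _ => q) :=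
  ⟨0, fun _ => ⟨univ, fun _ => q, isOpen_univ, contMDiffOn_const, mem_univ _,
    fun _ _ _ _ => rfl⟩⟩

theorem jetSmooth_base [IsManifold 𝓘(ℝ, EX) ∞ X] : JetSmooth EX JZ 𝓘(ℝ, EX) base map base := by
  refine ⟨0, fun i₀ => ⟨Prod.fst ⁻¹' (extChartAt 𝓘(ℝ, EX) (base i₀)).target,
    fun p => (extChartAt 𝓘(ℝ, EX) (base i₀)).symm p.1,
    (isOpen_extChartAt_target _).preimage continuous_fst, ?_, ?_, ?_⟩⟩
  · exact (contMDiffOn_extChartAt_symm _).comp (contDiff_fst.contMDiff).contMDiffOn fun p hp => hp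
  · exact mem_extChartAt_target _
  · intro i h1 _ _
    exact ((extChartAt 𝓘(ℝ, EX) (base i₀)).left_inv h1).symm

/-- A function of jets takes the same value on equal germs. -/
theorem jetSmooth_value [IsManifold JZ ∞ Z] [JZ.Boundaryless] :
    JetSmooth EX JZ JZ base map (fun i => map i (base i)) := by
  have hval : ∀ (x₀ x : X) (z₀ : Z) (S : X → Z), x ∈ (extChartAt 𝓘(ℝ, EX) x₀).source →
      continuousMultilinearCurryFin0 ℝ EX EZ ((jetCoord (EX := EX) JZ 0 x₀ z₀ x S).2 0)
        = extChartAt JZ z₀ (S x) := by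
    intro x₀ x z₀ S hx
    change (extChartAt JZ z₀ ∘ S ∘ (extChartAt 𝓘(ℝ, EX) x₀).symm) _ = _
    simp only [Function.comp_apply]
    rw [(extChartAt 𝓘(ℝ, EX) x₀).left_inv hx]
  have hL : ContDiff ℝ ∞ (fun p : JetSpace EX EZ 0 =>
      continuousMultilinearCurryFin0 ℝ EX EZ (p.2 0)) :=
    (LinearIsometryEquiv.contDiff _).comp
      ((ContinuousLinearMap.proj (R := ℝ) (φ := fun k : Fin (0 + 1) => EX [×(k : ℕ)]→L[ℝ] EZ)
        0).contDiff.comp contDiff_snd)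
  refine ⟨0, fun i₀ => ⟨(fun p : JetSpace EX EZ 0 =>
      continuousMultilinearCurryFin0 ℝ EX EZ (p.2 0)) ⁻¹'
        (extChartAt JZ (map i₀ (base i₀))).target,
    fun p => (extChartAt JZ (map i₀ (base i₀))).symm
      (continuousMultilinearCurryFin0 ℝ EX EZ (p.2 0)),
    (isOpen_extChartAt_target _).preimage hL.continuous, ?_, ?_, ?_⟩⟩
  · exact (contMDiffOn_extChartAt_symm _).comp hL.contMDiff.contMDiffOn fun p hp => hp
  · simp only [mem_preimage]
    rw [hval _ _ _ _ (mem_extChartAt_source _)]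
    exact mem_extChartAt_target _
  · intro i h1 h2 _
    simp only
    rw [hval _ _ _ _ h1, (extChartAt JZ _).left_inv h2]

theorem jetCoord_congr (r : ℕ) (x₀ : X) (z₀ : Z) {x : X} (hx : x ∈ (extChartAt 𝓘(ℝ, EX) x₀).source)
    {S T : X → Z} (h : S =ᶠ[𝓝 x] T) :
    jetCoord (EX := EX) JZ r x₀ z₀ x S = jetCoord JZ r x₀ z₀ x T := by
  refine jet_congr ?_
  have h1 : ∀ᶠ y in 𝓝 ((extChartAt 𝓘(ℝ, EX) x₀).symm (extChartAt 𝓘(ℝ, EX) x₀ x)), S y = T y := by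
    rw [(extChartAt 𝓘(ℝ, EX) x₀).left_inv hx]; exact h
  filter_upwards [(continuousAt_extChartAt_symm' hx).eventually h1] with u hu
  exact congrArg (extChartAt JZ z₀) hu

theorem JetSmooth.congr_jet {f : ι → Q} (hf : JetSmooth EX JZ JQ base map f) {i j : ι}
    (hb : base i = base j) (hm : map i =ᶠ[𝓝 (base j)] map j) : f i = f j := by
  obtain ⟨r, hr⟩ := hf
  obtain ⟨W, g, hW, hg, h0, hi⟩ := hr j
  have hc : jetCoord JZ r (base j) (map j (base j)) (base i) (map i)
      = jetCoord (EX := EX) JZ r (base j) (map j (base j)) (base j) (map j) := by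
    rw [hb]
    exact jetCoord_congr r _ _ (mem_extChartAt_source _) hm
  rw [hi i (by rw [hb]; exact mem_extChartAt_source _)
    (by rw [hb, hm.self_of_nhds]; exact mem_extChartAt_source _) (by rw [hc]; exact h0),
    hi j (mem_extChartAt_source _) (mem_extChartAt_source _) h0, hc]


theorem eventually_contDiffAt_coord [IsManifold 𝓘(ℝ, EX) ∞ X] [IsManifold JZ ∞ Z] {x₀ x : X} {z₀ : Z} {S : X → Z}
    (hx : x ∈ (extChartAt 𝓘(ℝ, EX) x₀).source) (hz : S x ∈ (extChartAt JZ z₀).source)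
    (hS : ∀ᶠ y in 𝓝 x, ContMDiffAt 𝓘(ℝ, EX) JZ ∞ S y) :
    ∀ᶠ u in 𝓝 (extChartAt 𝓘(ℝ, EX) x₀ x), ContDiffAt ℝ ∞
      (extChartAt JZ z₀ ∘ S ∘ (extChartAt 𝓘(ℝ, EX) x₀).symm) u := by
  have h1 : ∀ᶠ y in 𝓝 x, ContMDiffAt 𝓘(ℝ, EX) JZ ∞ S y ∧ S y ∈ (extChartAt JZ z₀).source :=
    hS.and (hS.self_of_nhds.continuousAt.eventually_mem ((isOpen_extChartAt_source z₀).mem_nhds hz))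
  rw [← (extChartAt 𝓘(ℝ, EX) x₀).left_inv hx] at h1
  filter_upwards [(continuousAt_extChartAt_symm' hx).eventually h1,
    (isOpen_extChartAt_target (I := 𝓘(ℝ, EX)) x₀).mem_nhds ((extChartAt 𝓘(ℝ, EX) x₀).map_source hx)]
    with u hu hut
  rw [← contMDiffAt_iff_contDiffAt]
  refine ContMDiffAt.comp u ?_ (hu.1.comp u ?_)
  · exact contMDiffAt_extChartAt' (by simpa using hu.2)
  · exact (contMDiffOn_extChartAt_symm x₀).contMDiffAt
      ((isOpen_extChartAt_target (I := 𝓘(ℝ, EX)) x₀).mem_nhds hut)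

/-- A smooth function of jets, evaluated along a smooth map, is smooth at the base point. -/
theorem JetSmooth.contMDiffAt [IsManifold 𝓘(ℝ, EX) ∞ X] [IsManifold JZ ∞ Z] {f : ι → Q}
    (hf : JetSmooth EX JZ JQ base map f) {i : ι}
    (hs : ∀ᶠ y in 𝓝 (base i), ContMDiffAt 𝓘(ℝ, EX) JZ ∞ (map i) y) {T : X → Q}
    (hT : ∀ᶠ y in 𝓝 (base i), ∃ i', base i' = y ∧ map i' =ᶠ[𝓝 y] map i ∧ T y = f i') :
    ContMDiffAt 𝓘(ℝ, EX) JQ ∞ T (base i) := by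
  obtain ⟨r, hr⟩ := hf
  obtain ⟨W, g, hW, hg, h0, hi⟩ := hr i
  have hv := eventually_contDiffAt_coord (JZ := JZ) (EX := EX) (mem_extChartAt_source (base i))
    (mem_extChartAt_source (I := JZ) (map i (base i))) hs
  have hj := contDiffAt_jet (r := r) hv.self_of_nhds
  have hc : ContMDiffAt 𝓘(ℝ, EX) 𝓘(ℝ, JetSpace EX EZ r) ∞
      (fun y => jetCoord JZ r (base i) (map i (base i)) y (map i)) (base i) :=
    ContMDiffAt.comp (base i) hj.contMDiffAt contMDiffAt_extChartAt
  have hgc : ContMDiffAt 𝓘(ℝ, EX) JQ ∞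
      (fun y => g (jetCoord JZ r (base i) (map i (base i)) y (map i))) (base i) :=
    ContMDiffAt.comp (base i) (hg.contMDiffAt (hW.mem_nhds h0)) hc
  refine hgc.congr_of_eventuallyEq ?_
  filter_upwards [hT, hc.continuousAt.eventually_mem (hW.mem_nhds h0),
    (isOpen_extChartAt_source (I := 𝓘(ℝ, EX)) (base i)).mem_nhds (mem_extChartAt_source _),
    hs.self_of_nhds.continuousAt.eventually_mem
      ((isOpen_extChartAt_source (I := JZ) (map i (base i))).mem_nhds (mem_extChartAt_source _))]
    with y hy hyW hys hyz
  obtain ⟨i', hb, hm, hTy⟩ := hy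
  have hcc := jetCoord_congr (JZ := JZ) r (base i) (map i (base i)) hys hm
  subst hb
  rw [hTy, hi i' hys (by rw [hm.self_of_nhds]; exact hyz) (by rw [hcc]; exact hyW), hcc]

theorem JetSmooth.eventually_contMDiffAt [IsManifold 𝓘(ℝ, EX) ∞ X] [IsManifold JZ ∞ Z]
    {f : ι → Q} (hf : JetSmooth EX JZ JQ base map f) {i : ι}
    (hs : ∀ᶠ y in 𝓝 (base i), ContMDiffAt 𝓘(ℝ, EX) JZ ∞ (map i) y) {T : X → Q}
    (hT : ∀ᶠ y in 𝓝 (base i), ∃ i', base i' = y ∧ map i' =ᶠ[𝓝 y] map i ∧ T y = f i') :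
    ∀ᶠ y in 𝓝 (base i), ContMDiffAt 𝓘(ℝ, EX) JQ ∞ T y := by
  filter_upwards [hs.eventually_nhds, hT.eventually_nhds] with y h1 h2
  obtain ⟨i', hb, hm, -⟩ := h2.self_of_nhds
  subst hb
  refine hf.contMDiffAt (i := i') ?_ ?_
  · filter_upwards [h1, hm.eventually_nhds] with y hy1 hy2
    exact hy1.congr_of_eventuallyEq hy2
  · filter_upwards [h2, hm.eventually_nhds] with y hy1 hy2
    obtain ⟨j, a, b, c⟩ := hy1
    exact ⟨j, a, b.trans (EventuallyEq.symm hy2), c⟩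

/-- Substituting the prolongation of a jet-smooth map `B` into a jet-smooth function `f` gives a
jet-smooth function. -/
theorem JetSmooth.comp_prolong [FiniteDimensional ℝ EX] [IsManifold 𝓘(ℝ, EX) ∞ X]
    [IsManifold JZ ∞ Z] [IsManifold JQ' ∞ Q'] {base' : κ → X} {map' : κ → X → Q'}
    {B : ι → Q'} (hB : JetSmooth EX JZ JQ' base map B)
    {f : κ → Q} (hf : JetSmooth EX JQ' JQ base' map' f)
    (hs : ∀ i, ∀ᶠ y in 𝓝 (base i), ContMDiffAt 𝓘(ℝ, EX) JZ ∞ (map i) y)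
    (A : ι → κ) (hA : ∀ i, base' (A i) = base i)
    (hAB : ∀ i, ∀ᶠ y in 𝓝 (base i), ∃ i', base i' = y ∧ map i' =ᶠ[𝓝 y] map i ∧
      map' (A i) y = B i') :
    JetSmooth EX JZ JQ base map (fun i => f (A i)) := by
  have hAB0 : ∀ i, map' (A i) (base i) = B i := fun i => by
    obtain ⟨i', hb, hm, h⟩ := (hAB i).self_of_nhds
    rw [h]
    exact hB.congr_jet hb hm
  obtain ⟨r, hr⟩ := hf
  obtain ⟨k, hk⟩ := hB
  refine ⟨k + r, fun i₀ => ?_⟩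
  obtain ⟨Wf, gf, hWf, hgf, hf0, hfi⟩ := hr (A i₀)
  obtain ⟨WB, gB, hWB, hgB, hB0, hBi⟩ := hk i₀
  rw [hA, hAB0] at hf0 hfi
  set χ := extChartAt 𝓘(ℝ, EX) (base i₀) with hχ
  set φ := extChartAt JZ (map i₀ (base i₀)) with hφ
  set ψ := extChartAt JQ' (B i₀) with hψ
  let W1 : Set (JetSpace EX EZ k) := WB ∩ gB ⁻¹' ψ.source
  have hW1 : IsOpen W1 := hgB.continuousOn.isOpen_inter_preimage hWB (isOpen_extChartAt_source _)
  let G : JetSpace EX EZ k → EQ' := fun p => ψ (gB p)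
  have hG : ContDiffOn ℝ ∞ G W1 := by
    rw [← contMDiffOn_iff_contDiffOn]
    exact (contMDiffOn_extChartAt (n := ∞)).comp (hgB.mono inter_subset_left)
      (fun p hp => by simpa [ψ] using hp.2)
  choose Gj hGj hGjv using fun j : ℕ => exists_prolong hW1 hG j
  -- the coordinates
  let T : ∀ j : Fin (r + 1), JetSpace EX EZ (k + r) →L[ℝ] JetSpace EX EZ (k + (j : ℕ)) :=
    fun j => trunc (Nat.add_le_add_left (Nat.lt_succ_iff.1 j.2) k)
  let 𝒢 : JetSpace EX EZ (k + r) → JetSpace EX EQ' r := fun p => (p.1, fun j => Gj j (T j p))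
  let W2 : Set (JetSpace EX EZ (k + r)) := trunc (Nat.le_add_right k r) ⁻¹' W1
  have hW2 : IsOpen W2 := hW1.preimage (trunc _).continuous
  have h𝒢 : ContDiffOn ℝ ∞ 𝒢 W2 := by
    refine contDiff_fst.contDiffOn.prodMk (contDiffOn_pi.2 fun j => ?_)
    exact (hGj j).comp (T j).contDiff.contDiffOn fun p hp => hp
  have key : ∀ i, base i ∈ χ.source → map i (base i) ∈ φ.source →
      jetCoord JZ (k + r) (base i₀) (map i₀ (base i₀)) (base i) (map i) ∈ W2 →
      jetCoord JQ' r (base i₀) (B i₀) (base i) (map' (A i))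
        = 𝒢 (jetCoord JZ (k + r) (base i₀) (map i₀ (base i₀)) (base i) (map i)) := by
    intro i h1 h2 h3
    have hv := eventually_contDiffAt_coord (JZ := JZ) (EX := EX) h1 h2 (hs i)
    set v : EX → EZ := φ ∘ map i ∘ χ.symm with hvdef
    have hu : jet k v (χ (base i)) ∈ W1 := h3
    have hcont : ContinuousAt (jet k v) (χ (base i)) :=
      (contDiffAt_jet hv.self_of_nhds).continuousAt
    have hnear : ∀ᶠ y in 𝓝 (base i), y ∈ χ.source ∧ map i y ∈ φ.source ∧
        (∃ i', base i' = y ∧ map i' =ᶠ[𝓝 y] map i ∧ map' (A i) y = B i') := by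
      filter_upwards [hAB i, (isOpen_extChartAt_source (I := 𝓘(ℝ, EX)) (base i₀)).mem_nhds h1,
        (hs i).self_of_nhds.continuousAt.eventually_mem
          ((isOpen_extChartAt_source (I := JZ) (map i₀ (base i₀))).mem_nhds h2)] with y a b c
      exact ⟨b, c, a⟩
    rw [← χ.left_inv h1] at hnear
    have hev : (ψ ∘ map' (A i) ∘ χ.symm) =ᶠ[𝓝 (χ (base i))] fun u => G (jet k v u) := by
      filter_upwards [(continuousAt_extChartAt_symm' h1).eventually hnear,
        hcont.eventually_mem (hW1.mem_nhds hu),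
        (isOpen_extChartAt_target (I := 𝓘(ℝ, EX)) (base i₀)).mem_nhds (χ.map_source h1)]
        with u ⟨hu1, hu2, i', hb, hm, hu3⟩ huW hut
      have hcu : χ (χ.symm u) = u := χ.right_inv hut
      have e1 : jetCoord JZ k (base i₀) (map i₀ (base i₀)) (base i') (map i') = jet k v u := by
        rw [hb]
        have := jetCoord_congr (JZ := JZ) k (base i₀) (map i₀ (base i₀)) hu1 hm
        refine this.trans ?_
        unfold jetCoord
        rw [← hχ, hcu]
      have e2 := hBi i' (by rw [hb]; exact hu1) (by rw [hb, hm.self_of_nhds]; exact hu2)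
        (by rw [e1]; exact huW.1)
      simp only [Function.comp_apply, G]
      rw [hu3, e2, e1]
    have hj := jet_congr (r := r) hev
    refine hj.trans ?_
    refine Prod.ext rfl (funext fun j => ?_)
    exact hGjv j v (χ (base i)) hv hu
  refine ⟨W2 ∩ 𝒢 ⁻¹' Wf, gf ∘ 𝒢, h𝒢.continuousOn.isOpen_inter_preimage hW2 hWf, ?_, ?_, ?_⟩
  · exact hgf.comp ((contMDiffOn_iff_contDiffOn.2 h𝒢).mono inter_subset_left) fun p hp => hp.2
  · have hW20 : jetCoord JZ (k + r) (base i₀) (map i₀ (base i₀)) (base i₀) (map i₀) ∈ W2 := by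
      refine ⟨hB0, ?_⟩
      have := hBi i₀ (mem_extChartAt_source _) (mem_extChartAt_source _) hB0
      change gB (jetCoord JZ k (base i₀) (map i₀ (base i₀)) (base i₀) (map i₀)) ∈ ψ.source
      rw [← this]
      exact mem_extChartAt_source _
    refine ⟨hW20, ?_⟩
    change 𝒢 _ ∈ Wf
    rw [← key i₀ (mem_extChartAt_source _) (mem_extChartAt_source _) hW20]
    exact hf0
  · intro i h1 h2 h3
    have hk1 := key i h1 h2 h3.1
    have hBe : B i = gB (jetCoord JZ k (base i₀) (map i₀ (base i₀)) (base i) (map i)) :=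
      hBi i h1 h2 h3.1.1
    have := hfi (A i) (by rw [hA]; exact h1) (by
      rw [hA, hAB0, hBe]; exact h3.1.2) (by rw [hA, hk1]; exact h3.2)
    refine this.trans ?_
    rw [hA, hk1]
    rfl

end JetSmooth

section Functions

variable (EX : Type*) [NormedAddCommGroup EX] [NormedSpace ℝ EX]
  (EY : Type*) [NormedAddCommGroup EY] [NormedSpace ℝ EY]
  {X : Type*} [TopologicalSpace X] [ChartedSpace EX X]
  {Y : Type*} [TopologicalSpace Y] [ChartedSpace EY Y]

/-- `pr : Y → X` is a smooth fiber bundle with typical fiber the manifold `N`: it has smooth local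
trivializations with smooth inverses. -/
def IsSmoothFiberBundle (EN : Type*) [NormedAddCommGroup EN] [NormedSpace ℝ EN]
    (N : Type*) [TopologicalSpace N] [ChartedSpace EN N] (pr : Y → X) : Prop :=
  ∀ x : X, ∃ e : Trivialization N pr, x ∈ e.baseSet ∧
    ContMDiffOn 𝓘(ℝ, EY) (𝓘(ℝ, EX).prod 𝓘(ℝ, EN)) ∞ e e.source ∧
    ContMDiffOn (𝓘(ℝ, EX).prod 𝓘(ℝ, EN)) 𝓘(ℝ, EY) ∞ e.toOpenPartialHomeomorph.symm e.target

/-- `s` is a smooth section of `pr` on a neighbourhood of `x`. -/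
def IsLocalSection (pr : Y → X) (s : X → Y) (x : X) : Prop :=
  ∀ᶠ y in 𝓝 x, ContMDiffAt 𝓘(ℝ, EX) 𝓘(ℝ, EY) ∞ s y ∧ pr (s y) = y

/-- A point of the infinite order jet manifold of `pr : Y → X`, presented by a point `x` and a local
section `s` near `x`. Functions on jets are functions of these data that see only jets. -/
structure JetPoint (pr : Y → X) where
  x : X
  s : X → Y
  isSec : IsLocalSection EX EY pr s x

theorem JetPoint.smooth {pr : Y → X} (j : JetPoint EX EY pr) :
    ∀ᶠ y in 𝓝 j.x, ContMDiffAt 𝓘(ℝ, EX) 𝓘(ℝ, EY) ∞ j.s y := j.isSec.mono fun _ h => h.1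

/-- The smooth functions on the finite order jet manifolds of `pr : Y → X`, modulo pull-back: the
smooth finite order functions of jets of local sections. -/
def jetRing (pr : Y → X) : Subalgebra ℝ (JetPoint EX EY pr → ℝ) where
  carrier := {f | JetSmooth EX 𝓘(ℝ, EY) 𝓘(ℝ, ℝ) JetPoint.x JetPoint.s f}
  mul_mem' hf hg := JetSmooth.mul hf hg
  add_mem' hf hg := JetSmooth.add hf hg
  algebraMap_mem' r := jetSmooth_const r

variable (F : Type*) [NormedAddCommGroup F] [NormedSpace ℝ F]
  (E : X → Type*) [TopologicalSpace (TotalSpace F E)] [∀ x, AddCommGroup (E x)]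
  [∀ x, Module ℝ (E x)] [∀ x, TopologicalSpace (E x)] [FiberBundle F E]

/-- `σ` is a smooth section of the vector bundle `E` on a neighbourhood of `x`. -/
def IsSmoothNear (σ : ∀ y, E y) (x : X) : Prop :=
  ∀ᶠ y in 𝓝 x, ContMDiffAt 𝓘(ℝ, EX) (𝓘(ℝ, EX).prod 𝓘(ℝ, F)) ∞
    (fun z => TotalSpace.mk' F z (σ z)) y

/-- A jet of a local section of the fibred product of `Y` and the vector bundle `E`, presented by a
pair of local sections. -/
structure PairPoint (pr : Y → X) where
  jet : JetPoint EX EY pr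
  σ : ∀ y, E y
  isSec : IsSmoothNear EX F E σ jet.x

namespace PairPoint
variable {EX EY F E} {pr : Y → X}

abbrev x (p : PairPoint EX EY F E pr) : X := p.jet.x

def map (p : PairPoint EX EY F E pr) (y : X) : Y × TotalSpace F E :=
  (p.jet.s y, TotalSpace.mk' F y (p.σ y))

theorem smooth (p : PairPoint EX EY F E pr) : ∀ᶠ y in 𝓝 p.x, ContMDiffAt 𝓘(ℝ, EX)
    (𝓘(ℝ, EY).prod (𝓘(ℝ, EX).prod 𝓘(ℝ, F))) ∞ p.map y :=
  (p.jet.smooth.and p.isSec).mono fun _ h => h.1.prodMk h.2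

end PairPoint

/-- The smooth functions on the finite order jet manifolds of the fibred product of `Y` and `E` which
are linear in the jets of `E`, that is, the sections of the dual of the vector bundle
`J^r Y × J^r E → J^r Y`, for all `r` together. Locally they are the finite sums of `Φ_a^Λ c^a_Λ`. -/
def linFun (pr : Y → X) : Submodule ℝ (PairPoint EX EY F E pr → ℝ) where
  carrier := {Φ | JetSmooth EX (𝓘(ℝ, EY).prod (𝓘(ℝ, EX).prod 𝓘(ℝ, F))) 𝓘(ℝ, ℝ)
      PairPoint.x PairPoint.map Φ ∧
    ∀ (j : JetPoint EX EY pr) (a b : ℝ) (σ τ : ∀ y, E y) (hσ hτ h),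
      Φ ⟨j, a • σ + b • τ, h⟩ = a * Φ ⟨j, σ, hσ⟩ + b * Φ ⟨j, τ, hτ⟩}
  add_mem' {Φ Ψ} hΦ hΨ := ⟨JetSmooth.add hΦ.1 hΨ.1, fun j a b σ τ hσ hτ h => by
    simp only [Pi.add_apply]
    rw [hΦ.2 j a b σ τ hσ hτ h, hΨ.2 j a b σ τ hσ hτ h]; ring⟩
  zero_mem' := ⟨jetSmooth_const 0, fun j a b σ τ hσ hτ h => by simp⟩
  smul_mem' c Φ hΦ := ⟨JetSmooth.mul (jetSmooth_const c) hΦ.1, fun j a b σ τ hσ hτ h => by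
    simp only [Pi.smul_apply, smul_eq_mul]
    rw [hΦ.2 j a b σ τ hσ hτ h]; ring⟩

/-- The commutative ring `O_∞ Y` of smooth functions on finite order jet manifolds of `Y`. -/
def JetFun (pr : Y → X) : Type _ := jetRing EX EY pr

instance (pr : Y → X) : CommRing (JetFun EX EY pr) := inferInstanceAs (CommRing (jetRing EX EY pr))

/-- The module over `O_∞ Y` locally generated by the jets `c^a_Λ` of the fibre coordinates of `E`. -/
def LinFun (pr : Y → X) : Type _ := linFun EX EY F E pr

instance (pr : Y → X) : AddCommGroup (LinFun EX EY F E pr) :=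
  inferInstanceAs (AddCommGroup (linFun EX EY F E pr))

/-- The ring of smooth real functions on `X`. -/
abbrev SmoothFun (EX : Type*) [NormedAddCommGroup EX] [NormedSpace ℝ EX]
    (X : Type*) [TopologicalSpace X] [ChartedSpace EX X] : Type _ :=
  ContMDiffMap 𝓘(ℝ, EX) 𝓘(ℝ, ℝ) X ℝ ∞

/-- Smooth functions on the total space of `E` that are linear on fibres, that is, smooth sections of
the dual bundle of `E`. -/
def dualSec : Submodule ℝ (TotalSpace F E → ℝ) where
  carrier := {φ | ContMDiff (𝓘(ℝ, EX).prod 𝓘(ℝ, F)) 𝓘(ℝ, ℝ) ∞ φ ∧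
    ∀ (x : X) (a b : ℝ) (u v : E x), φ (TotalSpace.mk' F x (a • u + b • v))
      = a * φ (TotalSpace.mk' F x u) + b * φ (TotalSpace.mk' F x v)}
  add_mem' {φ ψ} hφ hψ := ⟨hφ.1.add hψ.1, fun x a b u v => by
    simp only [Pi.add_apply]
    rw [hφ.2, hψ.2]; ring⟩
  zero_mem' := ⟨contMDiff_const, fun x a b u v => by simp⟩
  smul_mem' c φ hφ := ⟨contMDiff_const.mul hφ.1, fun x a b u v => by
    simp only [Pi.smul_apply, smul_eq_mul]
    rw [hφ.2]; ring⟩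

/-- The module over the smooth functions on `X` of smooth sections of the dual bundle of `E`. -/
def DualSec : Type _ := dualSec EX F E

instance : AddCommGroup (DualSec EX F E) := inferInstanceAs (AddCommGroup (dualSec EX F E))

variable {EX EY F E} {pr : Y → X}

instance : Module (SmoothFun EX X) (DualSec EX F E) where
  smul f φ := ⟨fun v => f v.proj * φ.1 v,
    (f.contMDiff.comp (contMDiff_proj E)).mul φ.2.1, fun x a b u v => by
      change f x * _ = a * (f x * _) + b * (f x * _)
      rw [φ.2.2]; ring⟩
  one_smul φ := Subtype.ext (funext fun v => one_mul _)
  mul_smul f g φ := Subtype.ext (funext fun v => mul_assoc _ _ _)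
  smul_zero f := Subtype.ext (funext fun v => mul_zero _)
  zero_smul φ := Subtype.ext (funext fun v => zero_mul _)
  smul_add f φ ψ := Subtype.ext (funext fun v => mul_add _ _ _)
  add_smul f g φ := Subtype.ext (funext fun v => add_mul _ _ _)


variable [IsManifold 𝓘(ℝ, EX) ∞ X] [IsManifold 𝓘(ℝ, EY) ∞ Y] [FiniteDimensional ℝ EX]
  [VectorBundle ℝ F E] [ContMDiffVectorBundle ∞ F E 𝓘(ℝ, EX)]

/-- A function of jets of `Y` is a function of jets of the fibred product. -/
theorem jetSmooth_comp_jet {f : JetPoint EX EY pr → ℝ} (hf : f ∈ jetRing EX EY pr) :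
    JetSmooth EX (𝓘(ℝ, EY).prod (𝓘(ℝ, EX).prod 𝓘(ℝ, F))) 𝓘(ℝ, ℝ) PairPoint.x PairPoint.map
      (fun p : PairPoint EX EY F E pr => f p.jet) := by
  have hB : JetSmooth EX (𝓘(ℝ, EY).prod (𝓘(ℝ, EX).prod 𝓘(ℝ, F))) 𝓘(ℝ, EY) PairPoint.x
      PairPoint.map (fun p : PairPoint EX EY F E pr => p.jet.s p.x) :=
    JetSmooth.comp_contMDiff jetSmooth_value (h := Prod.fst) contMDiff_fst
  refine JetSmooth.comp_prolong hB hf PairPoint.smooth PairPoint.jet (fun _ => rfl) fun p => ?_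
  filter_upwards [p.jet.isSec.eventually_nhds, p.isSec.eventually_nhds] with y h1 h2
  exact ⟨⟨⟨y, p.jet.s, h1⟩, p.σ, h2⟩, rfl, EventuallyEq.rfl, rfl⟩

instance : Module (JetFun EX EY pr) (LinFun EX EY F E pr) where
  smul f Φ := ⟨fun p => f.1 p.jet * Φ.1 p, JetSmooth.mul (jetSmooth_comp_jet f.2) Φ.2.1,
    fun j a b σ τ hσ hτ h => by
      change f.1 j * _ = a * (f.1 j * _) + b * (f.1 j * _)
      rw [Φ.2.2 j a b σ τ hσ hτ h]; ring⟩
  one_smul Φ := Subtype.ext (funext fun _ => one_mul _)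
  mul_smul f g Φ := Subtype.ext (funext fun _ => mul_assoc _ _ _)
  smul_zero f := Subtype.ext (funext fun _ => mul_zero _)
  zero_smul Φ := Subtype.ext (funext fun _ => zero_mul _)
  smul_add f Φ Ψ := Subtype.ext (funext fun _ => mul_add _ _ _)
  add_smul f g Φ := Subtype.ext (funext fun _ => add_mul _ _ _)

instance : Algebra (SmoothFun EX X) (JetFun EX EY pr) :=
  RingHom.toAlgebra
    { toFun := fun f => ⟨fun j => f j.x, jetSmooth_base.comp_contMDiff f.contMDiff⟩
      map_one' := rfl
      map_mul' := fun _ _ => rfl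
      map_zero' := rfl
      map_add' := fun _ _ => rfl }

instance : Module (SmoothFun EX X) (LinFun EX EY F E pr) :=
  Module.compHom _ (algebraMap (SmoothFun EX X) (JetFun EX EY pr))

instance : IsScalarTower (SmoothFun EX X) (JetFun EX EY pr) (LinFun EX EY F E pr) :=
  ⟨fun _ _ _ => Subtype.ext (funext fun _ => mul_assoc _ _ _)⟩

variable (EX EY F E pr)

/-- An `E`-valued differential operator on `Y`: a smooth bundle map over `X` from a finite order jet
manifold of `Y` to `E`. -/
structure DiffOp where
  toFun : ∀ j : JetPoint EX EY pr, E j.x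
  smooth' : JetSmooth EX 𝓘(ℝ, EY) (𝓘(ℝ, EX).prod 𝓘(ℝ, F)) JetPoint.x JetPoint.s
    (fun j => TotalSpace.mk' F j.x (toFun j))

variable (F' : Type*) [NormedAddCommGroup F'] [NormedSpace ℝ F']
  (E' : X → Type*) [TopologicalSpace (TotalSpace F' E')] [∀ x, AddCommGroup (E' x)]
  [∀ x, Module ℝ (E' x)] [∀ x, TopologicalSpace (E' x)] [FiberBundle F' E']

/-- A differential operator on the fibred product of `Y` and `E`, linear in the section of `E`, with
values in the vector bundle `E'`. In a local frame of `E'` its components are elements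
`Δ^r` of `LinFun`, so that it is a section of `E'` with coefficients in `LinFun`. -/
structure LinOp where
  toFun : ∀ p : PairPoint EX EY F E pr, E' p.x
  smooth' : JetSmooth EX (𝓘(ℝ, EY).prod (𝓘(ℝ, EX).prod 𝓘(ℝ, F))) (𝓘(ℝ, EX).prod 𝓘(ℝ, F'))
    PairPoint.x PairPoint.map (fun p => TotalSpace.mk' F' p.x (toFun p))
  linear' : ∀ (j : JetPoint EX EY pr) (a b : ℝ) (σ τ : ∀ y, E y) (hσ hτ h),
    (toFun ⟨j, a • σ + b • τ, h⟩ : E' j.x)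
      = a • (toFun ⟨j, σ, hσ⟩ : E' j.x) + b • (toFun ⟨j, τ, hτ⟩ : E' j.x)

variable {EX EY F E pr F' E'} [VectorBundle ℝ F' E'] [ContMDiffVectorBundle ∞ F' E' 𝓘(ℝ, EX)]

open Classical in
/-- The section `y ↦ ℰ(j_y s)` of `E` (zero where `s` is not a local section of `Y`). -/
def DiffOp.along (ℰ : DiffOp EX EY F E pr) (s : X → Y) (y : X) : E y :=
  if h : IsLocalSection EX EY pr s y then ℰ.toFun ⟨y, s, h⟩ else 0

theorem DiffOp.along_spec (ℰ : DiffOp EX EY F E pr) (j : JetPoint EX EY pr) :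
    ∀ᶠ y in 𝓝 j.x, ∃ j' : JetPoint EX EY pr, j'.x = y ∧ j'.s =ᶠ[𝓝 y] j.s ∧
      TotalSpace.mk' F y (ℰ.along j.s y) = TotalSpace.mk' F j'.x (ℰ.toFun j') := by
  filter_upwards [j.isSec.eventually_nhds] with y h1
  refine ⟨⟨y, j.s, h1⟩, rfl, EventuallyEq.rfl, ?_⟩
  exact congrArg (TotalSpace.mk' F y) (dif_pos (show IsLocalSection EX EY pr j.s y from h1))

/-- The jet of the pair `(s, ℰ(s))`. -/
def DiffOp.insert (ℰ : DiffOp EX EY F E pr) (j : JetPoint EX EY pr) : PairPoint EX EY F E pr :=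
  ⟨j, ℰ.along j.s, ℰ.smooth'.eventually_contMDiffAt j.smooth (ℰ.along_spec j)⟩

theorem DiffOp.jetSmooth_insert (ℰ : DiffOp EX EY F E pr) {Φ : PairPoint EX EY F E pr → ℝ}
    (hΦ : Φ ∈ linFun EX EY F E pr) : (fun j => Φ (ℰ.insert j)) ∈ jetRing EX EY pr := by
  have hB : JetSmooth EX 𝓘(ℝ, EY) (𝓘(ℝ, EY).prod (𝓘(ℝ, EX).prod 𝓘(ℝ, F))) JetPoint.x
      JetPoint.s (fun j : JetPoint EX EY pr => (j.s j.x, TotalSpace.mk' F j.x (ℰ.toFun j))) :=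
    jetSmooth_value.prodMk ℰ.smooth'
  refine JetSmooth.comp_prolong hB hΦ.1 (fun j => j.smooth) ℰ.insert (fun _ => rfl) fun j => ?_
  filter_upwards [ℰ.along_spec j] with y hy
  obtain ⟨j', h1, h2, h3⟩ := hy
  refine ⟨j', h1, h2, Prod.ext ?_ h3⟩
  subst h1
  exact h2.self_of_nhds.symm

/-- The linear form on `LinFun` substituting `ℰ(s)` for the section of `E`. Since the jet coordinates
of `ℰ(s)` are the total derivatives `d_Λ ℰ^a`, it is the form `c^a_Λ ↦ d_Λ ℰ^a`. -/
def DiffOp.koszulForm (ℰ : DiffOp EX EY F E pr) :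
    Module.Dual (JetFun EX EY pr) (LinFun EX EY F E pr) where
  toFun Φ := ⟨fun j => Φ.1 (ℰ.insert j), ℰ.jetSmooth_insert Φ.2⟩
  map_add' _ _ := rfl
  map_smul' _ _ := rfl

open Classical in
/-- The section `y ↦ Δ(j_y s, j_y σ)` of `E'` (zero where `s` or `σ` is not a smooth section). -/
def LinOp.along (Δ : LinOp EX EY F E pr F' E') (s : X → Y) (σ : ∀ y, E y) (y : X) : E' y :=
  if h : IsLocalSection EX EY pr s y ∧ IsSmoothNear EX F E σ y then
    Δ.toFun ⟨⟨y, s, h.1⟩, σ, h.2⟩ else 0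

theorem LinOp.along_spec (Δ : LinOp EX EY F E pr F' E') (p : PairPoint EX EY F E pr) :
    ∀ᶠ y in 𝓝 p.x, ∃ p' : PairPoint EX EY F E pr, p'.x = y ∧ p'.map =ᶠ[𝓝 y] p.map ∧
      TotalSpace.mk' F' y (Δ.along p.jet.s p.σ y) = TotalSpace.mk' F' p'.x (Δ.toFun p') := by
  filter_upwards [p.jet.isSec.eventually_nhds, p.isSec.eventually_nhds] with y h1 h2
  refine ⟨⟨⟨y, p.jet.s, h1⟩, p.σ, h2⟩, rfl, EventuallyEq.rfl, ?_⟩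
  exact congrArg (TotalSpace.mk' F' y) (dif_pos
    (show IsLocalSection EX EY pr p.jet.s y ∧ IsSmoothNear EX F E p.σ y from ⟨h1, h2⟩))

/-- The jet of the pair `(s, Δ(s, σ))`. -/
def LinOp.push (Δ : LinOp EX EY F E pr F' E') (p : PairPoint EX EY F E pr) :
    PairPoint EX EY F' E' pr :=
  ⟨p.jet, Δ.along p.jet.s p.σ, Δ.smooth'.eventually_contMDiffAt p.smooth (Δ.along_spec p)⟩

theorem LinOp.jetSmooth_push (Δ : LinOp EX EY F E pr F' E') {Φ : PairPoint EX EY F' E' pr → ℝ}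
    (hΦ : Φ ∈ linFun EX EY F' E' pr) : (fun p => Φ (Δ.push p)) ∈ linFun EX EY F E pr := by
  constructor
  · have hB : JetSmooth EX (𝓘(ℝ, EY).prod (𝓘(ℝ, EX).prod 𝓘(ℝ, F)))
        (𝓘(ℝ, EY).prod (𝓘(ℝ, EX).prod 𝓘(ℝ, F'))) PairPoint.x PairPoint.map
        (fun p : PairPoint EX EY F E pr =>
          (p.jet.s p.x, TotalSpace.mk' F' p.x (Δ.toFun p))) :=
      (JetSmooth.comp_contMDiff jetSmooth_value (h := Prod.fst) contMDiff_fst).prodMk Δ.smooth'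
    refine JetSmooth.comp_prolong hB hΦ.1 (fun p => p.smooth) Δ.push (fun _ => rfl) fun p => ?_
    filter_upwards [Δ.along_spec p] with y hy
    obtain ⟨p', h1, h2, h3⟩ := hy
    refine ⟨p', h1, h2, Prod.ext ?_ h3⟩
    subst h1
    exact (congrArg Prod.fst h2.self_of_nhds).symm
  · intro j a b σ τ hσ hτ h
    have hev : ∀ᶠ y in 𝓝 j.x, Δ.along j.s (a • σ + b • τ) y
        = (a • Δ.along j.s σ + b • Δ.along j.s τ) y := by
      filter_upwards [j.isSec.eventually_nhds, hσ.eventually_nhds, hτ.eventually_nhds,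
        h.eventually_nhds] with y h1 h2 h3 h4
      simp only [Pi.add_apply, Pi.smul_apply]
      have e2 : Δ.along j.s σ y = Δ.toFun ⟨⟨y, j.s, h1⟩, σ, h2⟩ := dif_pos ⟨h1, h2⟩
      have e3 : Δ.along j.s τ y = Δ.toFun ⟨⟨y, j.s, h1⟩, τ, h3⟩ := dif_pos ⟨h1, h3⟩
      have e4 : Δ.along j.s (a • σ + b • τ) y = Δ.toFun ⟨⟨y, j.s, h1⟩, _, h4⟩ := dif_pos ⟨h1, h4⟩
      rw [e2, e3, e4]
      exact Δ.linear' ⟨y, j.s, h1⟩ a b σ τ h2 h3 h4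
    have hs : IsSmoothNear EX F' E' (a • Δ.along j.s σ + b • Δ.along j.s τ) j.x := by
      filter_upwards [(Δ.push ⟨j, _, h⟩).isSec, hev.eventually_nhds] with y h1 h2
      refine h1.congr_of_eventuallyEq ?_
      filter_upwards [h2] with z hz
      exact congrArg (TotalSpace.mk' F' z) hz.symm
    refine Eq.trans ?_ (hΦ.2 j a b (Δ.along j.s σ) (Δ.along j.s τ) (Δ.push ⟨j, σ, hσ⟩).isSec
      (Δ.push ⟨j, τ, hτ⟩).isSec hs)
    refine JetSmooth.congr_jet hΦ.1 rfl ?_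
    filter_upwards [hev] with y hy
    exact Prod.ext rfl (congrArg (TotalSpace.mk' F' y) hy)

/-- Substitution of `Δ(s, σ)` for the section of `E'`. Locally `c^r_Ξ ↦ d_Ξ Δ^r`, hence
`G_r^Ξ c^r_Ξ ↦ G_r^Ξ d_Ξ Δ^r`. -/
def LinOp.pull (Δ : LinOp EX EY F E pr F' E') :
    LinFun EX EY F' E' pr →ₗ[JetFun EX EY pr] LinFun EX EY F E pr where
  toFun Φ := ⟨fun p => Φ.1 (Δ.push p), Δ.jetSmooth_push Φ.2⟩
  map_add' _ _ := rfl
  map_smul' _ _ := rfl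

/-- The component of `Δ` along a section of the dual bundle of `E'`; for the members of a local dual
frame these are the `Δ^r`. -/
def LinOp.component (Δ : LinOp EX EY F E pr F' E') (φ : DualSec EX F' E') :
    LinFun EX EY F E pr :=
  ⟨fun p => φ.1 (TotalSpace.mk' F' p.x (Δ.toFun p)), Δ.smooth'.comp_contMDiff φ.2.1,
    fun j a b σ τ hσ hτ h => by
      change φ.1 (TotalSpace.mk' F' j.x (Δ.toFun ⟨j, _, h⟩)) = _
      rw [Δ.linear' j a b σ τ hσ hτ h, φ.2.2]⟩

/-- An element of `LinFun` as an operator with values in functions on `X`. For `G` linear in jets of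
functions on `X`, locally `h ↦ G^Ξ d_Ξ h`, the element `Φ.toLinOp.pull G` is `G^Ξ d_Ξ Φ`. -/
def LinFun.toLinOp (Φ : LinFun EX EY F E pr) : LinOp EX EY F E pr ℝ (Bundle.Trivial X ℝ) where
  toFun p := Φ.1 p
  smooth' := by
    refine JetSmooth.comp_contMDiff (jetSmooth_base.prodMk Φ.2.1)
      (h := fun q : X × ℝ => (TotalSpace.mk' ℝ q.1 q.2 : TotalSpace ℝ (Bundle.Trivial X ℝ))) ?_
    intro q
    rw [contMDiffAt_totalSpace]
    exact ⟨contMDiffAt_fst, contMDiffAt_snd⟩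
  linear' := Φ.2.2

end Functions

section Homology

variable {EX : Type*} [NormedAddCommGroup EX] [NormedSpace ℝ EX] [FiniteDimensional ℝ EX]
  {EY : Type*} [NormedAddCommGroup EY] [NormedSpace ℝ EY]
  {X : Type*} [TopologicalSpace X] [ChartedSpace EX X] [IsManifold 𝓘(ℝ, EX) ∞ X]
  {Y : Type*} [TopologicalSpace Y] [ChartedSpace EY Y] [IsManifold 𝓘(ℝ, EY) ∞ Y]
  {F : Type*} [NormedAddCommGroup F] [NormedSpace ℝ F]
  {E : X → Type*} [TopologicalSpace (TotalSpace F E)] [∀ x, AddCommGroup (E x)]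
  [∀ x, Module ℝ (E x)] [∀ x, TopologicalSpace (E x)] [FiberBundle F E]
  [VectorBundle ℝ F E] [ContMDiffVectorBundle ∞ F E 𝓘(ℝ, EX)]
  {pr : Y → X}

variable (EX EY F E pr) in
/-- The ring `S_∞[E;Y]` of graded functions: the exterior algebra over `O_∞ Y` of the module of odd
generators `c^a_Λ`. -/
abbrev gradedRing : Type _ := ExteriorAlgebra (JetFun EX EY pr) (LinFun EX EY F E pr)

/-- The differential `δ` of `S_∞[E;Y]`: the contraction on the right with `c^a_Λ ↦ d_Λ ℰ^a`, that is,
the right graded derivation with `δ(f c) = -δ(f) c + f δ(c)` for `c` in `LinFun`. -/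
def koszul (ℰ : DiffOp EX EY F E pr) :
    gradedRing EX EY F E pr →ₗ[JetFun EX EY pr] gradedRing EX EY F E pr :=
  CliffordAlgebra.contractRight.flip ℰ.koszulForm

/-- The one-cycles of `δ`. -/
def cycles (ℰ : DiffOp EX EY F E pr) : Submodule (JetFun EX EY pr) (LinFun EX EY F E pr) :=
  LinearMap.ker (koszul ℰ ∘ₗ ExteriorAlgebra.ι (JetFun EX EY pr))

/-- The images under `δ` of the elements of degree two. -/
def boundaries (ℰ : DiffOp EX EY F E pr) : Submodule (JetFun EX EY pr) (LinFun EX EY F E pr) :=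
  ((⋀[JetFun EX EY pr]^2 (LinFun EX EY F E pr)).map (koszul ℰ)).comap
    (ExteriorAlgebra.ι (JetFun EX EY pr))

theorem koszul_koszul (ℰ : DiffOp EX EY F E pr) (a : gradedRing EX EY F E pr) :
    koszul ℰ (koszul ℰ a) = 0 := CliffordAlgebra.contractRight_contractRight _ _

theorem boundaries_le_cycles (ℰ : DiffOp EX EY F E pr) : boundaries ℰ ≤ cycles ℰ := by
  rintro Φ ⟨a, -, h⟩
  change koszul ℰ (ExteriorAlgebra.ι _ Φ) = 0
  rw [← h, koszul_koszul]

/-- The first homology of the complex `0 ← Im δ ← S_1 ← S_2`. -/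
abbrev H1 (ℰ : DiffOp EX EY F E pr) : Type _ :=
  cycles ℰ ⧸ (boundaries ℰ).submoduleOf (cycles ℰ)

/-- The first homology is finitely generated, with `C` the module of Noether operators: `C` is a
projective module of finite rank over the smooth functions on `X`, consisting of elements of `H1`
(the rank is a number, which is automatic if `X` is connected), and, with representatives chosen for
its elements, every cycle is up to a boundary a finite sum of `G^Ξ d_Ξ Δ` with `G^Ξ ∈ O_∞ Y` and
`Δ` the representative of an element of `C`. -/
structure IsNoetherModule (ℰ : DiffOp EX EY F E pr)
    (C : Submodule (SmoothFun EX X) (H1 ℰ)) : Prop where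
  finite : Module.Finite (SmoothFun EX X) C
  projective : Module.Projective (SmoothFun EX X) C
  rank : ∃ n : ℕ, ∀ P : PrimeSpectrum (SmoothFun EX X), Module.rankAtStalk C P = n
  factorizes : ∃ rep : C →ₗ[SmoothFun EX X] cycles ℰ,
    (∀ c : C, (Submodule.Quotient.mk (rep c) : H1 ℰ) = c) ∧
    ∀ Φ ∈ cycles ℰ, ∃ Ψ ∈ Submodule.span (JetFun EX EY pr)
        {Θ : LinFun EX EY F E pr | ∃ (c : C) (G : LinFun EX EY ℝ (Bundle.Trivial X ℝ) pr),
          Θ = (LinFun.toLinOp (rep c : LinFun EX EY F E pr)).pull G},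
      Φ - Ψ ∈ boundaries ℰ

variable {F₀ : Type*} [NormedAddCommGroup F₀] [NormedSpace ℝ F₀]
  {E₀ : X → Type*} [TopologicalSpace (TotalSpace F₀ E₀)] [∀ x, AddCommGroup (E₀ x)]
  [∀ x, Module ℝ (E₀ x)] [∀ x, TopologicalSpace (E₀ x)] [FiberBundle F₀ E₀]
  [VectorBundle ℝ F₀ E₀] [ContMDiffVectorBundle ∞ F₀ E₀ 𝓘(ℝ, EX)]

variable (EX EY F E pr F₀ E₀) in
/-- The ring `P_∞[E;Y;E₀]` of graded functions polynomial in the jets of the even variables `c^r`,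
which are the fibre coordinates of `E₀`. -/
abbrev extRing : Type _ :=
  gradedRing EX EY F E pr ⊗[JetFun EX EY pr]
    SymmetricAlgebra (JetFun EX EY pr) (LinFun EX EY F₀ E₀ pr)

variable (EX EY F E pr F₀ E₀) in
/-- The inclusion of `S_∞[E;Y]` in `P_∞[E;Y;E₀]`. -/
def inclS : gradedRing EX EY F E pr →ₐ[JetFun EX EY pr] extRing EX EY F E pr F₀ E₀ :=
  Algebra.TensorProduct.includeLeft

variable (EX EY F E pr F₀ E₀) in
/-- The odd generators, locally combinations of `c^a_Λ`, of antifield number 1. -/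
def oddGen : LinFun EX EY F E pr →ₗ[JetFun EX EY pr] extRing EX EY F E pr F₀ E₀ :=
  (inclS EX EY F E pr F₀ E₀).toLinearMap ∘ₗ ExteriorAlgebra.ι (JetFun EX EY pr)

variable (EX EY F E pr F₀ E₀) in
/-- The even generators, locally combinations of `c^r_Λ`, of antifield number 2. -/
def evenGen : LinFun EX EY F₀ E₀ pr →ₗ[JetFun EX EY pr] extRing EX EY F E pr F₀ E₀ :=
  (Algebra.TensorProduct.includeRight :
    SymmetricAlgebra (JetFun EX EY pr) (LinFun EX EY F₀ E₀ pr) →ₐ[JetFun EX EY pr]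
      extRing EX EY F E pr F₀ E₀).toLinearMap ∘ₗ
    SymmetricAlgebra.ι (JetFun EX EY pr) (LinFun EX EY F₀ E₀ pr)

variable (EX EY F E pr F₀ E₀) in
/-- The elements of degree `p` in the odd and degree `q` in the even generators; their Grassmann
parity is that of `p`. -/
def bidegree (p q : ℕ) : Submodule (JetFun EX EY pr) (extRing EX EY F E pr F₀ E₀) :=
  LinearMap.range (oddGen EX EY F E pr F₀ E₀) ^ p * LinearMap.range (evenGen EX EY F E pr F₀ E₀) ^ q

variable (EX EY F E pr F₀ E₀) in
/-- The elements of antifield number `k`. -/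
def antifield (k : ℕ) : Submodule (JetFun EX EY pr) (extRing EX EY F E pr F₀ E₀) :=
  ⨆ (p : ℕ) (q : ℕ) (_ : p + 2 * q = k), bidegree EX EY F E pr F₀ E₀ p q

/-- `D` is the right graded derivation `δ + ∂_r Δ^r` of `P_∞[E;Y;E₀]`: it is `O_∞ Y`-linear, it satisfies
`D(f f') = (-1)^[f'] D(f) f' + f D(f')`, and `D(c^a_Λ) = d_Λ ℰ^a`, `D(c^r_Ξ) = d_Ξ Δ^r`. -/
structure IsKoszulTate (ℰ : DiffOp EX EY F E pr) (Δ : LinOp EX EY F E pr F₀ E₀)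
    (D : extRing EX EY F E pr F₀ E₀ →ₗ[JetFun EX EY pr] extRing EX EY F E pr F₀ E₀) :
    Prop where
  map_mul : ∀ (p q : ℕ) (f f' : extRing EX EY F E pr F₀ E₀),
    f' ∈ bidegree EX EY F E pr F₀ E₀ p q → D (f * f') = (-1) ^ p * (D f * f') + f * D f'
  map_odd : ∀ Φ : LinFun EX EY F E pr,
    D (oddGen EX EY F E pr F₀ E₀ Φ) = algebraMap (JetFun EX EY pr) _ (ℰ.koszulForm Φ)
  map_even : ∀ G : LinFun EX EY F₀ E₀ pr,
    D (evenGen EX EY F E pr F₀ E₀ G) = oddGen EX EY F E pr F₀ E₀ (Δ.pull G)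

/-- The identities `Δ_a^{Λ r} d_Λ ℰ^a = 0` in `O_∞ Y`, that is, `Δ(s, ℰ(s)) = 0` on all jets. -/
def NoetherIdentities (ℰ : DiffOp EX EY F E pr) (Δ : LinOp EX EY F E pr F₀ E₀) : Prop :=
  ∀ j : JetPoint EX EY pr, Δ.toFun (ℰ.insert j) = 0

variable (F₀ E₀) in
/-- The terms of `0 ← Im δ ← S_∞[E;Y]_1 ← P_∞[E;Y;E₀]_2 ← P_∞[E;Y;E₀]_3`. -/
def chain (ℰ : DiffOp EX EY F E pr) :
    ℕ → Submodule (JetFun EX EY pr) (extRing EX EY F E pr F₀ E₀)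
  | 0 => (LinearMap.range ℰ.koszulForm).map (Algebra.linearMap (JetFun EX EY pr) _)
  | 1 => ((⋀[JetFun EX EY pr]^1 (LinFun EX EY F E pr)).map
      (inclS EX EY F E pr F₀ E₀).toLinearMap)
  | 2 => antifield EX EY F E pr F₀ E₀ 2
  | 3 => antifield EX EY F E pr F₀ E₀ 3
  | _ => ⊥

/-- With the differential `D` the terms `chain` form a chain complex whose homology of degrees 0 and 1
is trivial. -/
structure IsOneExactComplex (ℰ : DiffOp EX EY F E pr)
    (D : extRing EX EY F E pr F₀ E₀ →ₗ[JetFun EX EY pr] extRing EX EY F E pr F₀ E₀) :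
    Prop where
  map_chain : ∀ k : ℕ, ∀ Φ ∈ chain F₀ E₀ ℰ (k + 1), D Φ ∈ chain F₀ E₀ ℰ k
  comp_zero : ∀ k : ℕ, ∀ Φ ∈ chain F₀ E₀ ℰ (k + 2), D (D Φ) = 0
  exact_zero : ∀ Φ ∈ chain F₀ E₀ ℰ 0, ∃ Ψ ∈ chain F₀ E₀ ℰ 1, D Ψ = Φ
  exact_one : ∀ Φ ∈ chain F₀ E₀ ℰ 1, D Φ = 0 → ∃ Ψ ∈ chain F₀ E₀ ℰ 2, D Ψ = Φ

/-- `S_∞[E;Y]` is a subring of `P_∞[E;Y;E₀]`, compatibly with antifield numbers and with no other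
elements of antifield number 1, and `D` restricts to `δ` on it. -/
structure ExtendsKoszul (ℰ : DiffOp EX EY F E pr)
    (D : extRing EX EY F E pr F₀ E₀ →ₗ[JetFun EX EY pr] extRing EX EY F E pr F₀ E₀) :
    Prop where
  injective : Function.Injective (inclS EX EY F E pr F₀ E₀)
  le_antifield : ∀ k : ℕ, (⋀[JetFun EX EY pr]^k (LinFun EX EY F E pr)).map
    (inclS EX EY F E pr F₀ E₀).toLinearMap ≤ antifield EX EY F E pr F₀ E₀ k
  antifield_one : antifield EX EY F E pr F₀ E₀ 1 = chain F₀ E₀ ℰ 1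
  comm : ∀ a : gradedRing EX EY F E pr,
    D (inclS EX EY F E pr F₀ E₀ a) = inclS EX EY F E pr F₀ E₀ (koszul ℰ a)

end Homology
end NoetherKT
end

open NoetherKT

/-! The argument separates into algebra over `O_∞ Y` and the construction of the bundle.

Algebra. On the exterior algebra of `M` tensored with the symmetric algebra of `N`, a form `α` on
`M` and a linear map `β : N → M` extend to exactly one right graded derivation: it contracts odd
generators by `α` and replaces even ones by `β`. Existence is `derivation`, assembled from right
contraction and a derivation of the symmetric algebra; uniqueness follows because the generators
generate. Its square kills the odd generators and sends an even `n` to `α (β n)`, so it vanishes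
exactly when `α ∘ β = 0` (`comp_self_eq_zero_iff`). Here `α` is `ℰ.koszulForm` and `β` is `Δ.pull`,
and `α ∘ β = 0` says that `Δ(s, ℰ(s))` vanishes for all `s` (`noetherIdentities_iff`).

Bundle. A finitely generated projective module `C` is a direct summand of a free module, through `f`
onto `C` and a section `s` of `f`. The idempotent matrix of `s ∘ f` depends smoothly on the point of
`X` and has constant rank `n`, namely the rank of `C`. The ranges of the transposed matrices form a
smooth vector bundle `E₀`, and the sections of its dual are `C` (`dualEquiv`). The transpose is
taken because the tuple of representatives of the generators `f (Pi.single i 1)` is fixed by it;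
projected to `E₀`, this tuple is `Δ`, and its component along a dual section is the representative
of the corresponding class (`component_toLinOp`).

Exactness. Total derivatives of components of `Δ` are of the form `Δ.pull G` (`pull_pull_toLinFun`).
Hence the finite generation hypothesis writes each one-cycle as `δ a + Δ.pull G`, which is the image
of `a` plus the even generator of `G` (`isOneExactComplex_koszulTate`). -/

noncomputable section
namespace KoszulTate

/-! ### Right graded derivations of an algebra with odd and even generators. -/

section Abstract

variable {A M N B : Type*} [CommRing A] [AddCommGroup M] [Module A M] [AddCommGroup N] [Module A N]
  [Ring B] [Algebra A B]

/-- `D` is an `A`-linear right graded derivation of the algebra `B`, given on products with the odd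
generators `o` and the even generators `e`, on which it takes the values `α` and `o ∘ β`. -/
structure IsGradedDerivation (o : M →ₗ[A] B) (e : N →ₗ[A] B) (α : Module.Dual A M) (β : N →ₗ[A] M)
    (D : B →ₗ[A] B) : Prop where
  map_one : D 1 = 0
  map_mul_odd' : ∀ f m, D (f * o m) + D f * o m = α m • f
  map_mul_even : ∀ f n, D (f * e n) = D f * e n + f * o (β n)

/-- The elements which, as right factors, satisfy the Leibniz rule with sign `ε`. -/
def leibnizSubmodule (D : B →ₗ[A] B) (ε : ℤ) : Submodule A B where
  carrier := {g | ∀ f, D (f * g) = ε • (D f * g) + f * D g}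
  add_mem' {g g'} h h' f := by
    rw [mul_add, map_add, h, h', map_add, mul_add, mul_add, smul_add]; abel
  zero_mem' f := by simp
  smul_mem' a g h f := by
    rw [mul_smul_comm, map_smul, h, map_smul, mul_smul_comm, mul_smul_comm, smul_add,
      smul_comm a ε]

/-- Moving `D` past two factors in turn multiplies the signs. This reduces the Leibniz rule for
arbitrary right factors to generators. -/
theorem leibnizSubmodule_mul_le (D : B →ₗ[A] B) (ε ε' : ℤ) :
    leibnizSubmodule D ε * leibnizSubmodule D ε' ≤ leibnizSubmodule D (ε * ε') := by
  refine Submodule.mul_le.2 fun g h g' h' f => ?_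
  rw [← mul_assoc, h' (f * g), h f, h' g, add_mul, smul_mul_assoc, smul_add, smul_smul, mul_add,
    mul_smul_comm, mul_assoc, mul_assoc, mul_assoc, mul_comm ε', add_assoc]

/-- Induction with the product rule; `D 1 = 0` is what the power zero, the scalars, needs. -/
theorem pow_le_leibnizSubmodule {D : B →ₗ[A] B} (h1 : D 1 = 0)
    {S : Submodule A B} {ε : ℤ} (hS : S ≤ leibnizSubmodule D ε) (p : ℕ) :
    S ^ p ≤ leibnizSubmodule D (ε ^ p) := by
  induction p with
  | zero =>
    rw [pow_zero, pow_zero, Submodule.one_le]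
    intro f
    simp [h1]
  | succ p ih =>
    rw [pow_succ, pow_succ]
    exact (mul_le_mul' ih hS).trans (leibnizSubmodule_mul_le D _ _)

/-- The elements of degree `k`, odd generators counting once and even ones twice. -/
def degree (o : M →ₗ[A] B) (e : N →ₗ[A] B) (k : ℕ) : Submodule A B :=
  ⨆ (p : ℕ) (q : ℕ) (_ : p + 2 * q = k), LinearMap.range o ^ p * LinearMap.range e ^ q

/-- The elements of degree `k - 1`; zero for `k = 0`. -/
def lowerDegree (o : M →ₗ[A] B) (e : N →ₗ[A] B) : ℕ → Submodule A B
  | 0 => ⊥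
  | k + 1 => degree o e k

variable {o : M →ₗ[A] B} {e : N →ₗ[A] B} {α : Module.Dual A M} {β : N →ₗ[A] M} {D D' : B →ₗ[A] B}

theorem le_degree (o : M →ₗ[A] B) (e : N →ₗ[A] B) {p q k : ℕ} (h : p + 2 * q = k) :
    LinearMap.range o ^ p * LinearMap.range e ^ q ≤ degree o e k :=
  le_iSup_of_le p (le_iSup_of_le q (le_iSup_of_le h le_rfl))

theorem pow_range_le_degree (o : M →ₗ[A] B) (e : N →ₗ[A] B) (k : ℕ) :
    LinearMap.range o ^ k ≤ degree o e k := by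
  simpa using le_degree o e (p := k) (q := 0) rfl

theorem degree_one (o : M →ₗ[A] B) (e : N →ₗ[A] B) : degree o e 1 = LinearMap.range o := by
  refine le_antisymm ?_ ?_
  · refine iSup_le fun p => iSup_le fun q => iSup_le fun h => ?_
    obtain ⟨rfl, rfl⟩ : p = 1 ∧ q = 0 := by omega
    simp
  · simpa using pow_range_le_degree o e 1

theorem range_even_le_degree (o : M →ₗ[A] B) (e : N →ₗ[A] B) :
    LinearMap.range e ≤ degree o e 2 := by
  simpa using le_degree o e (p := 0) (q := 1) rfl

/-- Products in `degree` have their odd factors on the left, so a new odd factor on the right must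
first be moved past the even ones. -/
theorem degree_mul_odd (hc : ∀ m n, Commute (o m) (e n)) {k : ℕ} {f : B} (hf : f ∈ degree o e k)
    (m : M) : f * o m ∈ degree o e (k + 1) := by
  have : degree o e k ≤ (degree o e (k + 1)).comap (LinearMap.mulRight A (o m)) := by
    refine iSup_le fun p => iSup_le fun q => iSup_le fun h => Submodule.mul_le.2 fun a ha b hb => ?_
    have hcb : Commute (o m) b := by
      -- The centralizer of `o m` is a subalgebra containing the even generators, hence all their
      -- products.
      have hle : ∀ r : ℕ, LinearMap.range e ^ r ≤
          Subalgebra.toSubmodule (Subalgebra.centralizer A {o m}) := by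
        intro r
        induction r with
        | zero => rw [pow_zero]; exact Submodule.one_le.2 (one_mem (Subalgebra.centralizer A {o m}))
        | succ r ih =>
          rw [pow_succ]
          refine Submodule.mul_le.2 fun x hx y hy => mul_mem (S := Subalgebra A B) (ih hx) ?_
          obtain ⟨n, rfl⟩ := hy
          exact (Subalgebra.mem_centralizer_iff A).2 fun g hg => by
            rw [Set.mem_singleton_iff.1 hg]; exact (hc m n).eq
      exact (Subalgebra.mem_centralizer_iff A).1 (hle q hb) _ rfl
    change a * b * o m ∈ degree o e (k + 1)
    rw [mul_assoc, ← hcb.eq, ← mul_assoc]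
    refine le_degree o e (p := p + 1) (q := q) (by omega) (Submodule.mul_mem_mul ?_ hb)
    rw [pow_succ]
    exact Submodule.mul_mem_mul ha ⟨m, rfl⟩
  exact this hf

theorem degree_mul_even {k : ℕ} {f : B} (hf : f ∈ degree o e k) (n : N) :
    f * e n ∈ degree o e (k + 2) := by
  have : degree o e k ≤ (degree o e (k + 2)).comap (LinearMap.mulRight A (e n)) := by
    refine iSup_le fun p => iSup_le fun q => iSup_le fun h => Submodule.mul_le.2 fun a ha b hb => ?_
    change a * b * e n ∈ degree o e (k + 2)
    rw [mul_assoc]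
    refine le_degree o e (p := p) (q := q + 1) (by omega) (Submodule.mul_mem_mul ha ?_)
    rw [pow_succ]
    exact Submodule.mul_mem_mul hb ⟨n, rfl⟩
  exact this hf

/-- Induction on an element as an iterated product of generators. -/
theorem induction_mul_right
    (hgen : ∀ S : Subalgebra A B, (∀ m, o m ∈ S) → (∀ n, e n ∈ S) → S = ⊤)
    {p : B → Prop} (one : p 1) (add : ∀ f g, p f → p g → p (f + g))
    (smul : ∀ (a : A) f, p f → p (a • f)) (odd : ∀ f m, p f → p (f * o m))
    (even : ∀ f n, p f → p (f * e n)) (f : B) : p f := by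
  -- The elements by which right multiplication preserves `p` form a subalgebra; it contains the
  -- generators, and applying it to `1` gives the claim.
  let S : Subalgebra A B :=
    { carrier := {g | ∀ f, p f → p (f * g)}
      mul_mem' := fun {g g'} h h' f hf => by
        rw [← mul_assoc]; exact h' _ (h _ hf)
      add_mem' := fun {g g'} h h' f hf => by
        rw [mul_add]; exact add _ _ (h f hf) (h' f hf)
      algebraMap_mem' := fun a f hf => by
        rw [← Algebra.commutes, ← Algebra.smul_def]; exact smul a f hf }
  have hS : f ∈ S := by
    rw [hgen S (fun m f hf => odd f m hf) (fun n f hf => even f n hf)]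
    trivial
  simpa using hS 1 one

namespace IsGradedDerivation

theorem map_mul_odd (h : IsGradedDerivation o e α β D) (f : B) (m : M) :
    D (f * o m) = -(D f * o m) + α m • f := by
  rw [← h.map_mul_odd']; abel

theorem map_odd (h : IsGradedDerivation o e α β D) (m : M) : D (o m) = algebraMap A B (α m) := by
  have := h.map_mul_odd 1 m
  rwa [one_mul, h.map_one, zero_mul, neg_zero, zero_add, ← Algebra.algebraMap_eq_smul_one] at this

theorem map_even (h : IsGradedDerivation o e α β D) (n : N) : D (e n) = o (β n) := by
  have := h.map_mul_even 1 n
  rwa [one_mul, h.map_one, zero_mul, zero_add, one_mul] at this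

/-- Odd generators obey the rule with sign `-1`, even ones with sign `1`; a product of `p` odd and
`q` even ones therefore obeys it with sign `(-1) ^ p`. -/
theorem leibniz (h : IsGradedDerivation o e α β D) (p q : ℕ) (f f' : B)
    (hf' : f' ∈ LinearMap.range o ^ p * LinearMap.range e ^ q) :
    D (f * f') = (-1) ^ p * (D f * f') + f * D f' := by
  have ho : LinearMap.range o ≤ leibnizSubmodule D (-1) := by
    rintro _ ⟨m, rfl⟩ f
    rw [h.map_mul_odd, h.map_odd, neg_smul, one_smul, ← Algebra.commutes, ← Algebra.smul_def]
  have he : LinearMap.range e ≤ leibnizSubmodule D 1 := by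
    rintro _ ⟨n, rfl⟩ f
    rw [h.map_mul_even, h.map_even, one_smul]
  have := ((mul_le_mul' (pow_le_leibnizSubmodule h.map_one ho p)
    (pow_le_leibnizSubmodule h.map_one he q)).trans (leibnizSubmodule_mul_le _ _ _)) hf' f
  rw [this, one_pow, mul_one, zsmul_eq_mul]
  push_cast
  rfl

theorem of_leibniz (hm : ∀ (p q : ℕ) (f f' : B),
      f' ∈ LinearMap.range o ^ p * LinearMap.range e ^ q →
        D (f * f') = (-1) ^ p * (D f * f') + f * D f')
    (ho : ∀ m, D (o m) = algebraMap A B (α m)) (he : ∀ n, D (e n) = o (β n)) :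
    IsGradedDerivation o e α β D where
  map_one := by
    -- The rule for `1 * 1` reads `D 1 = D 1 + D 1`.
    have := hm 0 0 1 1 (by simpa using ⟨1, _root_.map_one (algebraMap A B)⟩)
    simpa using this
  map_mul_odd' f m := by
    rw [hm 1 0 f _ (by simp), ho, ← Algebra.commutes, ← Algebra.smul_def, pow_one, neg_one_mul]
    abel
  map_mul_even f n := by
    rw [hm 0 1 f _ (by simp), he, pow_zero, one_mul]

theorem unique (hgen : ∀ S : Subalgebra A B, (∀ m, o m ∈ S) → (∀ n, e n ∈ S) → S = ⊤)
    (h : IsGradedDerivation o e α β D) (h' : IsGradedDerivation o e α β D') : D' = D := by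
  refine LinearMap.ext fun f => ?_
  induction f using induction_mul_right hgen with
  | one => rw [h.map_one, h'.map_one]
  | add f g hf hg => rw [map_add, map_add, hf, hg]
  | smul a f hf => rw [map_smul, map_smul, hf]
  | odd f m hf => rw [h.map_mul_odd, h'.map_mul_odd, hf]
  | even f n hf => rw [h.map_mul_even, h'.map_mul_even, hf]

/-- Applying `D` twice, the mixed terms cancel by sign: right multiplication by an odd generator
commutes with `D²`, while an even generator `n` contributes the extra term `α (β n) • f`. Conversely
`D² (e n)` is the scalar `α (β n)`, visible in `B` by injectivity of `algebraMap`. -/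
theorem comp_self_eq_zero_iff
    (hgen : ∀ S : Subalgebra A B, (∀ m, o m ∈ S) → (∀ n, e n ∈ S) → S = ⊤)
    (hinj : Function.Injective (algebraMap A B)) (h : IsGradedDerivation o e α β D) :
    (∀ f, D (D f) = 0) ↔ ∀ n, α (β n) = 0 := by
  constructor
  · intro hD n
    have := hD (e n)
    rw [h.map_even, h.map_odd] at this
    exact hinj (this.trans (map_zero _).symm)
  · intro hαβ f
    induction f using induction_mul_right hgen with
    | one => rw [h.map_one, map_zero]
    | add f g hf hg => rw [map_add, map_add, hf, hg, add_zero]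
    | smul a f hf => rw [map_smul, map_smul, hf, smul_zero]
    | odd f m hf =>
      rw [h.map_mul_odd, map_add, map_neg, h.map_mul_odd, hf, map_smul, zero_mul]
      abel
    | even f n hf =>
      rw [h.map_mul_even, map_add, h.map_mul_even, h.map_mul_odd, hf, hαβ, zero_mul, zero_smul]
      abel

/-- `D` replaces an odd generator by a scalar or an even one by an odd one, and either loses one
degree. The induction runs over `lowerDegree`, so that it can start at degree zero, where `D`
vanishes. -/
theorem map_degree (hc : ∀ m n, Commute (o m) (e n)) (h : IsGradedDerivation o e α β D) (k : ℕ)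
    {f : B} (hf : f ∈ degree o e (k + 1)) : D f ∈ degree o e k := by
  have ho : ∀ r, ∀ g ∈ lowerDegree o e r, ∀ m, g * o m ∈ lowerDegree o e (r + 1) := by
    rintro (_ | r) g hg m
    · rw [(Submodule.mem_bot A).1 hg, zero_mul]; exact zero_mem _
    · exact degree_mul_odd hc hg m
  have he : ∀ r, ∀ g ∈ lowerDegree o e r, ∀ n, g * e n ∈ lowerDegree o e (r + 2) := by
    rintro (_ | r) g hg n
    · rw [(Submodule.mem_bot A).1 hg, zero_mul]; exact zero_mem _
    · exact degree_mul_even hg n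
  have hp : ∀ p, LinearMap.range o ^ p ≤ (lowerDegree o e p).comap D := by
    intro p
    induction p with
    | zero =>
      rw [pow_zero, Submodule.one_le, Submodule.mem_comap, h.map_one]
      exact zero_mem _
    | succ p ih =>
      rw [pow_succ]
      refine Submodule.mul_le.2 ?_
      rintro g hg _ ⟨m, rfl⟩
      rw [Submodule.mem_comap, h.map_mul_odd]
      exact add_mem (neg_mem (ho _ _ (ih hg) m))
        (Submodule.smul_mem _ _ (pow_range_le_degree o e p hg))
  have hpq : ∀ p q, LinearMap.range o ^ p * LinearMap.range e ^ q ≤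
      (lowerDegree o e (p + 2 * q)).comap D := by
    intro p q
    induction q with
    | zero => simpa using hp p
    | succ q ih =>
      rw [pow_succ, ← mul_assoc]
      refine Submodule.mul_le.2 ?_
      rintro g hg _ ⟨n, rfl⟩
      rw [Submodule.mem_comap, h.map_mul_even]
      exact add_mem (he _ _ (ih hg) n) (degree_mul_odd hc (le_degree o e rfl hg) (β n))
  have hle : degree o e (k + 1) ≤ (degree o e k).comap D := by
    refine iSup_le fun p => iSup_le fun q => iSup_le fun hk => ?_
    have := hpq p q
    rwa [hk] at this
  exact hle hf

end IsGradedDerivation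

end Abstract

/-! ### Graded polynomials and the construction of the derivation. -/

section Polynomials

variable {A M N : Type*} [CommRing A] [AddCommGroup M] [Module A M] [AddCommGroup N] [Module A N]

variable (A M N) in
/-- The graded polynomials in odd generators `M` and even generators `N`. -/
abbrev GradedPoly : Type _ := ExteriorAlgebra A M ⊗[A] SymmetricAlgebra A N

variable (A M N) in
/-- The odd generators. -/
def odd : M →ₗ[A] GradedPoly A M N :=
  (Algebra.TensorProduct.includeLeft : ExteriorAlgebra A M →ₐ[A] GradedPoly A M N).toLinearMap ∘ₗ
    ExteriorAlgebra.ι A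

variable (A M N) in
/-- The even generators. -/
def even : N →ₗ[A] GradedPoly A M N :=
  (Algebra.TensorProduct.includeRight :
    SymmetricAlgebra A N →ₐ[A] GradedPoly A M N).toLinearMap ∘ₗ SymmetricAlgebra.ι A N

theorem odd_apply (m : M) : odd A M N m = ExteriorAlgebra.ι A m ⊗ₜ[A] 1 := rfl

theorem even_apply (n : N) : even A M N n = 1 ⊗ₜ[A] SymmetricAlgebra.ι A N n := rfl

/-- A subalgebra containing the generators is everything. -/
theorem eq_top_of_generators (S : Subalgebra A (GradedPoly A M N))
    (ho : ∀ m, odd A M N m ∈ S) (he : ∀ n, even A M N n ∈ S) : S = ⊤ := by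
  rw [eq_top_iff]
  rintro f -
  have h1 : ∀ w : ExteriorAlgebra A M, w ⊗ₜ[A] (1 : SymmetricAlgebra A N) ∈ S := by
    intro w
    induction w using ExteriorAlgebra.induction with
    | algebraMap r => exact S.algebraMap_mem r
    | ι m => exact ho m
    | mul a b ha hb => simpa using S.mul_mem ha hb
    | add a b ha hb => rw [TensorProduct.add_tmul]; exact S.add_mem ha hb
  have h2 : ∀ s : SymmetricAlgebra A N, (1 : ExteriorAlgebra A M) ⊗ₜ[A] s ∈ S := by
    intro s
    induction s using SymmetricAlgebra.induction with
    | algebraMap r =>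
      have := S.algebraMap_mem r
      rwa [Algebra.TensorProduct.algebraMap_apply'] at this
    | ι n => exact he n
    | mul a b ha hb => simpa using S.mul_mem ha hb
    | add a b ha hb => rw [TensorProduct.tmul_add]; exact S.add_mem ha hb
  induction f using TensorProduct.induction_on with
  | zero => exact S.zero_mem
  | tmul w s => simpa using S.mul_mem (h1 w) (h2 s)
  | add a b ha hb => exact S.add_mem ha hb

/-- The augmentation that sends all generators to zero is a left inverse. -/
theorem algebraMap_injective : Function.Injective (algebraMap A (GradedPoly A M N)) := by
  have h : ∀ a, Algebra.TensorProduct.lift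
      (ExteriorAlgebra.algebraMapInv : ExteriorAlgebra A M →ₐ[A] A)
      (SymmetricAlgebra.algebraMapInv : SymmetricAlgebra A N →ₐ[A] A)
      (fun _ _ => Commute.all _ _) (algebraMap A _ a) = a := fun a => by
    rw [AlgHom.commutes]; rfl
  exact Function.LeftInverse.injective h

/-- Setting only the even generators to zero is a left inverse. -/
theorem includeLeft_injective : Function.Injective
    (Algebra.TensorProduct.includeLeft : ExteriorAlgebra A M →ₐ[A] GradedPoly A M N) := by
  have h : ∀ a, Algebra.TensorProduct.lift (AlgHom.id A (ExteriorAlgebra A M))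
      ((Algebra.ofId A (ExteriorAlgebra A M)).comp
        (SymmetricAlgebra.algebraMapInv : SymmetricAlgebra A N →ₐ[A] A))
      (fun a b => Algebra.commute_algebraMap_right (SymmetricAlgebra.algebraMapInv b) a)
      ((Algebra.TensorProduct.includeLeft : ExteriorAlgebra A M →ₐ[A] GradedPoly A M N) a) = a :=
    fun a => (Algebra.TensorProduct.lift_tmul _ _ _ a 1).trans (by rw [map_one, mul_one]; rfl)
  exact Function.LeftInverse.injective h

section Construction

variable (α : Module.Dual A M) (β : N →ₗ[A] M)

/-- The derivation of the symmetric algebra extending `β`. -/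
def symDer : SymmetricAlgebra A N →ₗ[A] SymmetricAlgebra A N ⊗[A] M :=
  (TrivSqZeroExt.sndHom (SymmetricAlgebra A N) (SymmetricAlgebra A N ⊗[A] M)).restrictScalars A ∘ₗ
    (SymmetricAlgebra.lift
      ((TrivSqZeroExt.inlAlgHom A (SymmetricAlgebra A N)
          (SymmetricAlgebra A N ⊗[A] M)).toLinearMap ∘ₗ SymmetricAlgebra.ι A N +
        (TrivSqZeroExt.inrHom (SymmetricAlgebra A N)
          (SymmetricAlgebra A N ⊗[A] M)).restrictScalars A ∘ₗ
            TensorProduct.mk A (SymmetricAlgebra A N) M 1 ∘ₗ β)).toLinearMap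

/-- A derivation is the second component of an algebra homomorphism to a square-zero extension whose
first component is the identity; the Leibniz rule is multiplicativity of that homomorphism. -/
theorem symDer_mul_ι (s : SymmetricAlgebra A N) (n : N) :
    symDer β (s * SymmetricAlgebra.ι A N n) =
      s ⊗ₜ[A] β n + SymmetricAlgebra.ι A N n • symDer β s := by
  have hfst : ∀ s : SymmetricAlgebra A N, (SymmetricAlgebra.lift
      ((TrivSqZeroExt.inlAlgHom A (SymmetricAlgebra A N)
          (SymmetricAlgebra A N ⊗[A] M)).toLinearMap ∘ₗ SymmetricAlgebra.ι A N +
        (TrivSqZeroExt.inrHom (SymmetricAlgebra A N)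
          (SymmetricAlgebra A N ⊗[A] M)).restrictScalars A ∘ₗ
            TensorProduct.mk A (SymmetricAlgebra A N) M 1 ∘ₗ β) s).fst = s := by
    intro s
    -- The first component is an algebra homomorphism fixing the generators.
    have : (TrivSqZeroExt.fstHom A (SymmetricAlgebra A N) (SymmetricAlgebra A N ⊗[A] M)).comp
        (SymmetricAlgebra.lift
          ((TrivSqZeroExt.inlAlgHom A (SymmetricAlgebra A N)
            (SymmetricAlgebra A N ⊗[A] M)).toLinearMap ∘ₗ SymmetricAlgebra.ι A N +
          (TrivSqZeroExt.inrHom (SymmetricAlgebra A N)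
            (SymmetricAlgebra A N ⊗[A] M)).restrictScalars A ∘ₗ
              TensorProduct.mk A (SymmetricAlgebra A N) M 1 ∘ₗ β)) = AlgHom.id A _ := by
      ext n
      simp
    exact congrArg (fun f => f s) this
  simp only [symDer, LinearMap.comp_apply, AlgHom.toLinearMap_apply, map_mul,
    LinearMap.coe_restrictScalars, TrivSqZeroExt.sndHom_apply, TrivSqZeroExt.snd_mul, hfst]
  rw [SymmetricAlgebra.lift_ι_apply]
  simp [TensorProduct.smul_tmul']

theorem symDer_one : symDer β 1 = 0 := by
  simp [symDer]

/-- The elements linear in odd generators. -/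
def linearPart : SymmetricAlgebra A N ⊗[A] M →ₗ[A] GradedPoly A M N :=
  TensorProduct.map (ExteriorAlgebra.ι A) LinearMap.id ∘ₗ
    (TensorProduct.comm A (SymmetricAlgebra A N) M).toLinearMap

theorem linearPart_tmul (s : SymmetricAlgebra A N) (m : M) :
    linearPart (s ⊗ₜ[A] m) = ExteriorAlgebra.ι A m ⊗ₜ[A] s := rfl

/-- Elements linear in odd generators anticommute with odd generators. This makes the `β` part of
the derivation drop out of the rule for odd factors. -/
theorem odd_mul_linearPart (m : M) (t : SymmetricAlgebra A N ⊗[A] M) :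
    odd A M N m * linearPart t + linearPart t * odd A M N m = 0 := by
  induction t using TensorProduct.induction_on with
  | zero => simp
  | tmul s m' =>
    rw [linearPart_tmul, odd_apply, Algebra.TensorProduct.tmul_mul_tmul,
      Algebra.TensorProduct.tmul_mul_tmul, one_mul, mul_one, ← TensorProduct.add_tmul,
      ExteriorAlgebra.ι_add_mul_swap, TensorProduct.zero_tmul]
  | add a b ha hb => rw [map_add, mul_add, add_mul, add_add_add_comm, ha, hb, add_zero]

theorem linearPart_smul (n : N) (t : SymmetricAlgebra A N ⊗[A] M) :
    linearPart (SymmetricAlgebra.ι A N n • t) = linearPart t * even A M N n := by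
  induction t using TensorProduct.induction_on with
  | zero => simp
  | tmul s m =>
    rw [linearPart_tmul, even_apply, Algebra.TensorProduct.tmul_mul_tmul,
      TensorProduct.smul_tmul', linearPart_tmul, mul_one, smul_eq_mul, mul_comm]
  | add a b ha hb => rw [smul_add, map_add, map_add, add_mul, ha, hb]

/-- The right graded derivation which is `α` on odd and `β` on even generators. -/
def derivation : GradedPoly A M N →ₗ[A] GradedPoly A M N :=
  LinearMap.rTensor (SymmetricAlgebra A N) (CliffordAlgebra.contractRight.flip α) +
    TensorProduct.lift ((LinearMap.mul A (GradedPoly A M N)).compl₁₂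
      (Algebra.TensorProduct.includeLeft :
        ExteriorAlgebra A M →ₐ[A] GradedPoly A M N).toLinearMap
      (linearPart ∘ₗ symDer β))

theorem derivation_tmul (w : ExteriorAlgebra A M) (s : SymmetricAlgebra A N) :
    derivation α β (w ⊗ₜ[A] s) = CliffordAlgebra.contractRight w α ⊗ₜ[A] s +
      w ⊗ₜ[A] 1 * linearPart (symDer β s) := rfl

theorem derivation_tmul_one (w : ExteriorAlgebra A M) :
    derivation α β (w ⊗ₜ[A] 1) = CliffordAlgebra.contractRight w α ⊗ₜ[A] 1 := by
  rw [derivation_tmul, symDer_one, map_zero, mul_zero, add_zero]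

theorem derivation_one : derivation α β 1 = 0 := by
  rw [Algebra.TensorProduct.one_def, derivation_tmul_one, CliffordAlgebra.contractRight_one,
    TensorProduct.zero_tmul]

/-- The contraction part supplies `α m • f` by the rule for right contraction of a product; the two
terms with `linearPart` cancel by anticommutation. -/
theorem derivation_mul_odd (f : GradedPoly A M N) (m : M) :
    derivation α β (f * odd A M N m) + derivation α β f * odd A M N m = α m • f := by
  induction f using TensorProduct.induction_on with
  | zero => simp
  | tmul w s =>
    have h1 : ∀ s' : SymmetricAlgebra A N,
        w ⊗ₜ[A] s' * odd A M N m = (w * ExteriorAlgebra.ι A m) ⊗ₜ[A] s' := by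
      intro s'
      rw [odd_apply, Algebra.TensorProduct.tmul_mul_tmul, mul_one]
    have h2 : CliffordAlgebra.contractRight w α ⊗ₜ[A] s * odd A M N m =
        (CliffordAlgebra.contractRight w α * ExteriorAlgebra.ι A m) ⊗ₜ[A] s := by
      rw [odd_apply, Algebra.TensorProduct.tmul_mul_tmul, mul_one]
    have h3 : CliffordAlgebra.contractRight (w * ExteriorAlgebra.ι A m) α +
        CliffordAlgebra.contractRight w α * ExteriorAlgebra.ι A m = α m • w :=
      eq_sub_iff_add_eq.1 (CliffordAlgebra.contractRight_mul_ι _ _ _)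
    rw [h1, derivation_tmul, derivation_tmul, ← h1, mul_assoc, add_mul, h2, mul_assoc,
      add_add_add_comm, ← mul_add, odd_mul_linearPart, mul_zero, add_zero,
      ← TensorProduct.add_tmul, h3, TensorProduct.smul_tmul']
  | add a b ha hb =>
    rw [add_mul, map_add, map_add, add_mul, add_add_add_comm, ha, hb, smul_add]

/-- Contraction ignores even factors, so only the Leibniz rule of `symDer` adds a term. -/
theorem derivation_mul_even (f : GradedPoly A M N) (n : N) :
    derivation α β (f * even A M N n) =
      derivation α β f * even A M N n + f * odd A M N (β n) := by
  induction f using TensorProduct.induction_on with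
  | zero => simp
  | tmul w s =>
    rw [even_apply, Algebra.TensorProduct.tmul_mul_tmul, mul_one, derivation_tmul, derivation_tmul,
      symDer_mul_ι, map_add, linearPart_smul, linearPart_tmul, add_mul, mul_add, even_apply,
      odd_apply]
    simp only [Algebra.TensorProduct.tmul_mul_tmul, mul_one, one_mul, mul_assoc]
    abel
  | add a b ha hb => rw [add_mul, map_add, ha, hb, map_add, add_mul, add_mul]; abel

end Construction


theorem odd_commute_even (m : M) (n : N) : Commute (odd A M N m) (even A M N n) := by
  simp [Commute, SemiconjBy, odd_apply, even_apply]

theorem isGradedDerivation_derivation (α : Module.Dual A M) (β : N →ₗ[A] M) :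
    IsGradedDerivation (odd A M N) (even A M N) α β (derivation α β) :=
  ⟨derivation_one α β, derivation_mul_odd α β, derivation_mul_even α β⟩

end Polynomials

end KoszulTate
end

noncomputable section
namespace SmoothProjection

/-! ### The vector bundle of ranges of a smooth family of projections. -/

section Core

variable (EX : Type*) [NormedAddCommGroup EX] [NormedSpace ℝ EX]
  (X : Type*) [TopologicalSpace X] [ChartedSpace EX X]
  (W : Type*) [NormedAddCommGroup W] [NormedSpace ℝ W] [FiniteDimensional ℝ W]

/-- A smooth family of projections of rank `n` of the vector space `W`. -/
structure Family (n : ℕ) where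
  toFun : X → W →L[ℝ] W
  smooth : ContMDiff 𝓘(ℝ, EX) 𝓘(ℝ, W →L[ℝ] W) ∞ toFun
  idem : ∀ x w, toFun x (toFun x w) = toFun x w
  finrank_range : ∀ x, Module.finrank ℝ (LinearMap.range (toFun x : W →ₗ[ℝ] W)) = n

variable {EX X W} {n : ℕ} (T : Family EX X W n)

namespace Family

theorem exists_frame (i : X) : ∃ (a : EuclideanSpace ℝ (Fin n) →L[ℝ] W)
    (b : W →L[ℝ] EuclideanSpace ℝ (Fin n)), (∀ v, b (a v) = v) ∧ ∀ v, T.toFun i (a v) = a v := by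
  have e : EuclideanSpace ℝ (Fin n) ≃ₗ[ℝ] LinearMap.range (T.toFun i : W →ₗ[ℝ] W) :=
    LinearEquiv.ofFinrankEq _ _ (by rw [T.finrank_range]; simp)
  refine ⟨((Submodule.subtype _).comp e.toLinearMap).toContinuousLinearMap,
    (e.symm.toLinearMap.comp (T.toFun i : W →ₗ[ℝ] W).rangeRestrict).toContinuousLinearMap,
    fun v => ?_, fun v => ?_⟩
  · have h : (T.toFun i : W →ₗ[ℝ] W).rangeRestrict (e v : W) = e v := by
      obtain ⟨w, hw⟩ := (e v).2
      refine Subtype.ext ?_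
      change T.toFun i (e v : W) = e v
      rw [← hw]
      exact T.idem i w
    change e.symm ((T.toFun i : W →ₗ[ℝ] W).rangeRestrict (e v : W)) = v
    rw [h, e.symm_apply_apply]
  · obtain ⟨w, hw⟩ := (e v).2
    change T.toFun i (e v : W) = e v
    rw [← hw]
    exact T.idem i w

/-- A frame of the range of the projection at `i`. -/
def frameAt (i : X) : EuclideanSpace ℝ (Fin n) →L[ℝ] W := (T.exists_frame i).choose

/-- A left inverse of `frameAt`. -/
def coframeAt (i : X) : W →L[ℝ] EuclideanSpace ℝ (Fin n) := (T.exists_frame i).choose_spec.choose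

theorem coframeAt_frameAt (i : X) (v) : T.coframeAt i (T.frameAt i v) = v :=
  (T.exists_frame i).choose_spec.choose_spec.1 v

theorem apply_frameAt (i : X) (v) : T.toFun i (T.frameAt i v) = T.frameAt i v :=
  (T.exists_frame i).choose_spec.choose_spec.2 v

/-- The frame at `i`, projected to the range of the projection at `x`. -/
def frame (i x : X) : EuclideanSpace ℝ (Fin n) →L[ℝ] W := (T.toFun x).comp (T.frameAt i)

/-- The endomorphism comparing the frames at `i` and at `x`. -/
def transition (i x : X) : EuclideanSpace ℝ (Fin n) →L[ℝ] EuclideanSpace ℝ (Fin n) :=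
  (T.coframeAt i).comp (T.frame i x)

/-- The left inverse of `frame`, on the domain `frameSet`. -/
def coframe (i x : X) : W →L[ℝ] EuclideanSpace ℝ (Fin n) :=
  (Ring.inverse (T.transition i x)).comp (T.coframeAt i)

/-- The set on which `frame i` is a frame. -/
def frameSet (i : X) : Set X := {x | IsUnit (T.transition i x)}

theorem contMDiff_frame (i : X) : ContMDiff 𝓘(ℝ, EX) 𝓘(ℝ, EuclideanSpace ℝ (Fin n) →L[ℝ] W) ∞
    (T.frame i) := T.smooth.clm_comp contMDiff_const

theorem contMDiff_transition (i : X) : ContMDiff 𝓘(ℝ, EX)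
    𝓘(ℝ, EuclideanSpace ℝ (Fin n) →L[ℝ] EuclideanSpace ℝ (Fin n)) ∞ (T.transition i) :=
  contMDiff_const.clm_comp (T.contMDiff_frame i)

theorem isOpen_frameSet (i : X) : IsOpen (T.frameSet i) :=
  Units.isOpen.preimage (T.contMDiff_transition i).continuous

/-- At `i` itself the projection fixes the frame, so the transition is the identity. With openness
of the units, the frame sets cover `X` by open sets. -/
theorem mem_frameSet_self (i : X) : i ∈ T.frameSet i := by
  have : T.transition i i = 1 := by
    ext1 v
    change T.coframeAt i (T.toFun i (T.frameAt i v)) = v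
    rw [apply_frameAt, coframeAt_frameAt]
  change IsUnit _
  rw [this]
  exact isUnit_one

theorem contMDiffOn_coframe (i : X) : ContMDiffOn 𝓘(ℝ, EX)
    𝓘(ℝ, W →L[ℝ] EuclideanSpace ℝ (Fin n)) ∞ (T.coframe i) (T.frameSet i) := by
  refine ContMDiffOn.clm_comp (fun x hx => ContMDiffAt.contMDiffWithinAt ?_) contMDiffOn_const
  obtain ⟨u, hu⟩ := hx
  have h1 : ContDiffAt ℝ ∞ Ring.inverse (T.transition i x) := by
    rw [← hu]; exact contDiffAt_ringInverse ℝ u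
  exact h1.contMDiffAt.comp x (T.contMDiff_transition i x)

theorem coframe_frame {i x : X} (hx : x ∈ T.frameSet i) (v) :
    T.coframe i x (T.frame i x v) = v := by
  have h : Ring.inverse (T.transition i x) * T.transition i x = 1 := Ring.inverse_mul_cancel _ hx
  exact congrArg (fun f : EuclideanSpace ℝ (Fin n) →L[ℝ] EuclideanSpace ℝ (Fin n) => f v) h

theorem apply_frame (i x : X) (v) : T.toFun x (T.frame i x v) = T.frame i x v := T.idem x _

/-- Constancy of the rank enters here: the frame is injective with image inside the range of the
projection, and both have dimension `n`, so the frame spans that range. -/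
theorem frame_coframe {i x : X} (hx : x ∈ T.frameSet i) {w : W} (hw : T.toFun x w = w) :
    T.frame i x (T.coframe i x w) = w := by
  have hinj : Function.Injective (T.frame i x) :=
    Function.LeftInverse.injective (T.coframe_frame hx)
  have hle : LinearMap.range (T.frame i x : EuclideanSpace ℝ (Fin n) →ₗ[ℝ] W) ≤
      LinearMap.range (T.toFun x : W →ₗ[ℝ] W) := by
    rintro _ ⟨v, rfl⟩
    exact ⟨_, rfl⟩
  have heq := Submodule.eq_of_le_of_finrank_eq hle (by
    rw [LinearMap.finrank_range_of_inj hinj, T.finrank_range]; simp)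
  have hmem : w ∈ LinearMap.range (T.frame i x : EuclideanSpace ℝ (Fin n) →ₗ[ℝ] W) := by
    rw [heq]; exact ⟨w, hw⟩
  obtain ⟨v, rfl⟩ := hmem
  exact congrArg (T.frame i x) (T.coframe_frame hx v)

theorem contMDiffOn_coordChange (i j : X) : ContMDiffOn 𝓘(ℝ, EX)
    𝓘(ℝ, EuclideanSpace ℝ (Fin n) →L[ℝ] EuclideanSpace ℝ (Fin n)) ∞
    (fun x => (T.coframe j x).comp (T.frame i x)) (T.frameSet i ∩ T.frameSet j) :=
  ((T.contMDiffOn_coframe j).mono inter_subset_right).clm_comp (T.contMDiff_frame i).contMDiffOn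

/-- The vector bundle of the ranges of the projections. -/
def core : VectorBundleCore ℝ X (EuclideanSpace ℝ (Fin n)) X where
  baseSet := T.frameSet
  isOpen_baseSet := T.isOpen_frameSet
  indexAt := id
  mem_baseSet_at := T.mem_frameSet_self
  coordChange i j x := (T.coframe j x).comp (T.frame i x)
  coordChange_self i x hx v := T.coframe_frame hx v
  continuousOn_coordChange i j := (T.contMDiffOn_coordChange i j).continuousOn
  coordChange_comp i j k x hx v := by
    change T.coframe k x (T.frame j x (T.coframe j x (T.frame i x v))) = _
    -- The cocycle identity: the `i`-frame takes values in the range, on which passing through the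
    -- `j`-coordinates is the identity.
    rw [T.frame_coframe hx.1.2 (T.apply_frame i x v)]
    rfl

instance : T.core.IsContMDiff 𝓘(ℝ, EX) ∞ := ⟨T.contMDiffOn_coordChange⟩

/-- The inclusion of the bundle of ranges. -/
def incl (x : X) : T.core.Fiber x →ₗ[ℝ] W :=
  (T.frame x x : EuclideanSpace ℝ (Fin n) →ₗ[ℝ] W)

/-- The projection to the bundle of ranges. -/
def proj (x : X) : W →ₗ[ℝ] T.core.Fiber x :=
  ((T.coframe x x).comp (T.toFun x) : W →ₗ[ℝ] EuclideanSpace ℝ (Fin n))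

theorem incl_proj (x : X) (w : W) : T.incl x (T.proj x w) = T.toFun x w :=
  T.frame_coframe (T.mem_frameSet_self x) (T.idem x w)

theorem proj_incl (x : X) (v : T.core.Fiber x) : T.proj x (T.incl x v) = v := by
  exact (congrArg (T.coframe x x) (T.apply_frame x x v)).trans
    (T.coframe_frame (T.mem_frameSet_self x) v)

/-- `incl` uses a frame whose index moves with the point and need not vary smoothly. Near `v₀` it
equals the frame of fixed index `v₀.proj` applied to the coordinates in that trivialization, and
this is smooth. -/
theorem contMDiff_incl : ContMDiff (𝓘(ℝ, EX).prod 𝓘(ℝ, EuclideanSpace ℝ (Fin n))) 𝓘(ℝ, W) ∞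
    (fun v : TotalSpace (EuclideanSpace ℝ (Fin n)) T.core.Fiber => T.incl v.proj v.2) := by
  intro v₀
  have h := (contMDiffAt_totalSpace (F := EuclideanSpace ℝ (Fin n)) (E := T.core.Fiber)
    (IM := 𝓘(ℝ, EX).prod 𝓘(ℝ, EuclideanSpace ℝ (Fin n))) (IB := 𝓘(ℝ, EX)) (n := ∞)
    (f := id) (x₀ := v₀)).1 contMDiffAt_id
  have h2 := ((T.contMDiff_frame v₀.proj).contMDiffAt.comp v₀ h.1).clm_apply h.2
  refine h2.congr_of_eventuallyEq ?_
  have hnear : ∀ᶠ v in 𝓝 v₀, v.proj ∈ T.frameSet v₀.proj :=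
    (FiberBundle.continuous_proj (EuclideanSpace ℝ (Fin n)) T.core.Fiber).continuousAt.eventually_mem
      ((T.isOpen_frameSet v₀.proj).mem_nhds (T.mem_frameSet_self _))
  filter_upwards [hnear] with v hv
  exact (T.frame_coframe hv (T.apply_frame v.proj v.proj v.2)).symm

/-- In the trivialization at `q₀.1` the projection is the coframe of fixed index applied to
`T.toFun`, since a change of coordinates includes into `W` and applies that coframe. -/
theorem contMDiff_proj : ContMDiff (𝓘(ℝ, EX).prod 𝓘(ℝ, W))
    (𝓘(ℝ, EX).prod 𝓘(ℝ, EuclideanSpace ℝ (Fin n))) ∞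
    (fun q : X × W => (TotalSpace.mk' (EuclideanSpace ℝ (Fin n)) q.1 (T.proj q.1 q.2) :
      TotalSpace (EuclideanSpace ℝ (Fin n)) T.core.Fiber)) := by
  intro q₀
  rw [contMDiffAt_totalSpace]
  refine ⟨contMDiffAt_fst, ?_⟩
  have hopen : T.frameSet q₀.1 ∈ 𝓝 q₀.1 :=
    (T.isOpen_frameSet q₀.1).mem_nhds (T.mem_frameSet_self _)
  have h1 := ((((T.contMDiffOn_coframe q₀.1).contMDiffAt hopen).comp q₀
    contMDiffAt_fst).clm_comp (T.smooth.contMDiffAt.comp q₀ contMDiffAt_fst)).clm_apply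
      (contMDiffAt_snd (I := 𝓘(ℝ, EX)) (J := 𝓘(ℝ, W)) (p := q₀))
  refine h1.congr_of_eventuallyEq ?_
  filter_upwards [continuousAt_fst.eventually_mem hopen] with q hq
  change T.coframe q₀.1 q.1 (T.incl q.1 (T.proj q.1 q.2)) = _
  rw [incl_proj]
  rfl

end Family

end Core

/-! ### From a projective module over the smooth functions to a family of projections. -/

section Module

variable {EX : Type*} [NormedAddCommGroup EX] [NormedSpace ℝ EX]
  {X : Type*} [TopologicalSpace X] [ChartedSpace EX X]
  {C : Type*} [AddCommGroup C] [Module (NoetherKT.SmoothFun EX X) C]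

open NoetherKT

/-- The value of the idempotent endomorphism `s ∘ f` at `x`, transposed. -/
def transposeAt {m : ℕ} (f : (Fin m → SmoothFun EX X) →ₗ[SmoothFun EX X] C)
    (s : C →ₗ[SmoothFun EX X] (Fin m → SmoothFun EX X)) (x : X) :
    (Fin m → ℝ) →L[ℝ] (Fin m → ℝ) :=
  (Matrix.toLin' (fun i j => s (f (Pi.single i 1)) j x)).toContinuousLinearMap

theorem transposeAt_apply {m : ℕ} (f : (Fin m → SmoothFun EX X) →ₗ[SmoothFun EX X] C)
    (s : C →ₗ[SmoothFun EX X] (Fin m → SmoothFun EX X)) (x : X) (w : Fin m → ℝ) (i : Fin m) :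
    transposeAt f s x w i = ∑ j, s (f (Pi.single i 1)) j x * w j := rfl

theorem contMDiff_transposeAt {m : ℕ} (f : (Fin m → SmoothFun EX X) →ₗ[SmoothFun EX X] C)
    (s : C →ₗ[SmoothFun EX X] (Fin m → SmoothFun EX X)) :
    ContMDiff 𝓘(ℝ, EX) 𝓘(ℝ, (Fin m → ℝ) →L[ℝ] (Fin m → ℝ)) ∞ (transposeAt f s) := by
  let L : (Fin m → Fin m → ℝ) →ₗ[ℝ] ((Fin m → ℝ) →L[ℝ] (Fin m → ℝ)) :=
    (LinearMap.toContinuousLinearMap.toLinearMap).comp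
      (Matrix.toLin' (R := ℝ) (m := Fin m) (n := Fin m)).toLinearMap
  have hL : ContMDiff 𝓘(ℝ, Fin m → Fin m → ℝ) 𝓘(ℝ, (Fin m → ℝ) →L[ℝ] (Fin m → ℝ)) ∞ L :=
    L.toContinuousLinearMap.contMDiff
  refine hL.comp (f := fun x : X => fun i j => s (f (Pi.single i 1)) j x) ?_
  exact contMDiff_pi_space.2 fun i => contMDiff_pi_space.2 fun j =>
    (s (f (Pi.single i 1)) j).contMDiff

/-- The coefficients `s c` of `c` with respect to the generators `f (Pi.single i 1)`. -/
theorem sum_smul_generators {m : ℕ} {f : (Fin m → SmoothFun EX X) →ₗ[SmoothFun EX X] C}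
    {s : C →ₗ[SmoothFun EX X] (Fin m → SmoothFun EX X)} (hfs : ∀ c, f (s c) = c) (c : C) :
    ∑ i, s c i • f (Pi.single i 1) = c := by
  conv_rhs => rw [← hfs c, ← Finset.univ_sum_single (s c), map_sum]
  refine Finset.sum_congr rfl fun i _ => ?_
  rw [← map_smul, ← Pi.single_smul, smul_eq_mul, mul_one]

/-- Expanding `c` in the generators and applying `s` shows that coefficient vectors are fixed by the
idempotent matrix, here read at a point. -/
theorem sum_coeff_generators {m : ℕ} {f : (Fin m → SmoothFun EX X) →ₗ[SmoothFun EX X] C}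
    {s : C →ₗ[SmoothFun EX X] (Fin m → SmoothFun EX X)} (hfs : ∀ c, f (s c) = c) (c : C)
    (j : Fin m) (x : X) : ∑ i, s c i x * s (f (Pi.single i 1)) j x = s c j x := by
  have h := congrArg (fun c => s c j) (sum_smul_generators hfs c)
  simp only [map_sum, map_smul, Finset.sum_apply, Pi.smul_apply, smul_eq_mul] at h
  -- Evaluation at `x` is taken as a ring homomorphism so that it passes through the sum.
  have h2 := congrArg (fun g => ContMDiffMap.evalRingHom (I := 𝓘(ℝ, EX)) (I' := 𝓘(ℝ, ℝ)) (n := ∞)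
    (R := ℝ) x g) h
  simp only [map_sum, map_mul] at h2
  exact h2

theorem transposeAt_idem {m : ℕ} {f : (Fin m → SmoothFun EX X) →ₗ[SmoothFun EX X] C}
    {s : C →ₗ[SmoothFun EX X] (Fin m → SmoothFun EX X)} (hfs : ∀ c, f (s c) = c) (x : X)
    (w : Fin m → ℝ) : transposeAt f s x (transposeAt f s x w) = transposeAt f s x w := by
  funext i
  simp only [transposeAt_apply, Finset.mul_sum]
  rw [Finset.sum_comm]
  refine Finset.sum_congr rfl fun j _ => ?_
  rw [← sum_coeff_generators hfs (f (Pi.single i 1)) j x, Finset.sum_mul]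
  exact Finset.sum_congr rfl fun k _ => (mul_assoc _ _ _).symm

/-- Evaluation at `x` makes `ℝ` an algebra over the smooth functions, and the fibre `ℝ ⊗ C` has
dimension the rank of `C` at the corresponding prime. The base change of `s` embeds this fibre as
the range of the evaluated idempotent, and transposing keeps the rank. -/
theorem finrank_range_transposeAt [Module.Finite (SmoothFun EX X) C]
    [Module.Projective (SmoothFun EX X) C] {n : ℕ}
    (hn : ∀ P : PrimeSpectrum (SmoothFun EX X), Module.rankAtStalk C P = n)
    {m : ℕ} {f : (Fin m → SmoothFun EX X) →ₗ[SmoothFun EX X] C}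
    {s : C →ₗ[SmoothFun EX X] (Fin m → SmoothFun EX X)} (hfs : ∀ c, f (s c) = c) (x : X) :
    Module.finrank ℝ (LinearMap.range
      (transposeAt f s x : (Fin m → ℝ) →ₗ[ℝ] (Fin m → ℝ))) = n := by
  let _ : Algebra (SmoothFun EX X) ℝ :=
    (ContMDiffMap.evalRingHom (I := 𝓘(ℝ, EX)) (I' := 𝓘(ℝ, ℝ)) (n := ∞) (R := ℝ) x).toAlgebra
  have hrank : Module.finrank ℝ (ℝ ⊗[SmoothFun EX X] C) = n := by
    -- The zero ideal is the prime of `ℝ`; its preimage is the ideal of functions vanishing at `x`.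
    have h1 := Module.rankAtStalk_baseChange (R := SmoothFun EX X) (M := C) (S := ℝ) ⊥
    rw [hn, Module.rankAtStalk_eq_finrank_of_free] at h1
    simpa using h1
  have hfs' : ∀ c, (f.baseChange ℝ) (s.baseChange ℝ c) = c := by
    intro c
    rw [← LinearMap.comp_apply, ← LinearMap.baseChange_comp,
      show f ∘ₗ s = LinearMap.id from LinearMap.ext hfs, LinearMap.baseChange_id]
    rfl
  have hrange : LinearMap.range ((s ∘ₗ f).baseChange ℝ) = LinearMap.range (s.baseChange ℝ) := by
    rw [LinearMap.baseChange_comp, LinearMap.range_comp_of_range_eq_top]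
    exact LinearMap.range_eq_top.2 (Function.RightInverse.surjective hfs')
  have h2 : Module.finrank ℝ (LinearMap.range ((s ∘ₗ f).baseChange ℝ)) = n := by
    rw [hrange, LinearMap.finrank_range_of_inj (Function.LeftInverse.injective hfs'), hrank]
  have h3 := LinearMap.toMatrix_baseChange ℝ (s ∘ₗ f) (Pi.basisFun (SmoothFun EX X) (Fin m))
    (Pi.basisFun (SmoothFun EX X) (Fin m))
  have h4 : (((LinearMap.toMatrix (Pi.basisFun (SmoothFun EX X) (Fin m))
      (Pi.basisFun (SmoothFun EX X) (Fin m))) (s ∘ₗ f)).map (algebraMap (SmoothFun EX X) ℝ)).rank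
        = n := by
    rw [← h3, Matrix.rank_eq_finrank_range_toLin _
      (Algebra.TensorProduct.basis ℝ (Pi.basisFun (SmoothFun EX X) (Fin m)))
      (Algebra.TensorProduct.basis ℝ (Pi.basisFun (SmoothFun EX X) (Fin m))),
      Matrix.toLin_toMatrix, h2]
  rw [← Matrix.rank_transpose, Matrix.rank_eq_finrank_range_toLin _ (Pi.basisFun ℝ (Fin m))
    (Pi.basisFun ℝ (Fin m)), Matrix.toLin_eq_toLin'] at h4
  rw [← h4]
  congr 3

/-- The projections whose ranges are the fibres of the bundle dual to the projective module `C`. -/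
def ofModule [Module.Finite (SmoothFun EX X) C] [Module.Projective (SmoothFun EX X) C] {n : ℕ}
    (hn : ∀ P : PrimeSpectrum (SmoothFun EX X), Module.rankAtStalk C P = n)
    {m : ℕ} {f : (Fin m → SmoothFun EX X) →ₗ[SmoothFun EX X] C}
    {s : C →ₗ[SmoothFun EX X] (Fin m → SmoothFun EX X)} (hfs : ∀ c, f (s c) = c) :
    Family EX X (Fin m → ℝ) n where
  toFun := transposeAt f s
  smooth := contMDiff_transposeAt f s
  idem := transposeAt_idem hfs
  finrank_range := finrank_range_transposeAt hn hfs

end Module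

end SmoothProjection
end

noncomputable section
namespace NoetherKT

/-! ### Summands of trivial bundles and sections of their duals. -/

section Retract

variable {EX : Type*} [NormedAddCommGroup EX] [NormedSpace ℝ EX]
  {X : Type*} [TopologicalSpace X] [ChartedSpace EX X]
  {F₀ : Type*} [NormedAddCommGroup F₀] [NormedSpace ℝ F₀]
  {E₀ : X → Type*} [TopologicalSpace (TotalSpace F₀ E₀)] [∀ x, AddCommGroup (E₀ x)]
  [∀ x, Module ℝ (E₀ x)] [∀ x, TopologicalSpace (E₀ x)] [FiberBundle F₀ E₀] {m : ℕ}

variable (EX F₀ E₀ m) in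
/-- The vector bundle `E₀` as a direct summand of the trivial bundle of rank `m`. -/
structure Retract where
  incl : ∀ x, E₀ x →ₗ[ℝ] (Fin m → ℝ)
  proj : ∀ x, (Fin m → ℝ) →ₗ[ℝ] E₀ x
  proj_incl : ∀ x v, proj x (incl x v) = v
  contMDiff_incl : ContMDiff (𝓘(ℝ, EX).prod 𝓘(ℝ, F₀)) 𝓘(ℝ, Fin m → ℝ) ∞
    (fun v : TotalSpace F₀ E₀ => incl v.proj v.2)
  contMDiff_proj : ContMDiff (𝓘(ℝ, EX).prod 𝓘(ℝ, Fin m → ℝ)) (𝓘(ℝ, EX).prod 𝓘(ℝ, F₀)) ∞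
    (fun q : X × (Fin m → ℝ) => (TotalSpace.mk' F₀ q.1 (proj q.1 q.2) : TotalSpace F₀ E₀))

namespace Retract

variable (ρ : Retract EX F₀ E₀ m)

/-- The coefficients of a section of the dual bundle with respect to the projected standard frame. -/
def coef : DualSec EX F₀ E₀ →ₗ[SmoothFun EX X] (Fin m → SmoothFun EX X) where
  toFun φ i := ⟨fun x => φ.1 (TotalSpace.mk' F₀ x (ρ.proj x (Pi.single i 1))),
    φ.2.1.comp (ρ.contMDiff_proj.comp (contMDiff_id.prodMk contMDiff_const))⟩
  map_add' _ _ := rfl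
  map_smul' _ _ := rfl

theorem dualSec_sum (φ : DualSec EX F₀ E₀) (x : X) {ι : Type*} (t : Finset ι) (a : ι → ℝ)
    (v : ι → E₀ x) : φ.1 (TotalSpace.mk' F₀ x (∑ i ∈ t, a i • v i)) =
      ∑ i ∈ t, a i * φ.1 (TotalSpace.mk' F₀ x (v i)) := by
  classical
  induction t using Finset.induction_on with
  | empty =>
    have := φ.2.2 x 0 0 0 0
    simpa using this
  | insert i t hi ih =>
    have := φ.2.2 x (a i) 1 (v i) (∑ i ∈ t, a i • v i)
    rw [one_smul, one_mul, ih] at this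
    rw [Finset.sum_insert hi, Finset.sum_insert hi, this]

variable [VectorBundle ℝ F₀ E₀]

/-- The section of the dual bundle with given coefficients. -/
def ofCoef : (Fin m → SmoothFun EX X) →ₗ[SmoothFun EX X] DualSec EX F₀ E₀ where
  toFun a := ⟨fun v => ∑ i, a i v.proj * ρ.incl v.proj v.2 i, by
      refine contMDiff_finsetSum fun i _ => ?_
      exact ((a i).contMDiff.comp (Bundle.contMDiff_proj E₀)).mul
        (contMDiff_pi_space.1 ρ.contMDiff_incl i), fun x a b u v => by
      simp only [map_add, map_smul, Pi.add_apply, Pi.smul_apply, smul_eq_mul, Finset.mul_sum,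
        ← Finset.sum_add_distrib]
      exact Finset.sum_congr rfl fun i _ => by ring⟩
  map_add' a b := Subtype.ext (funext fun v => by
    change ∑ i, (a i v.proj + b i v.proj) * ρ.incl v.proj v.2 i =
      ∑ i, a i v.proj * ρ.incl v.proj v.2 i + ∑ i, b i v.proj * ρ.incl v.proj v.2 i
    rw [← Finset.sum_add_distrib]
    exact Finset.sum_congr rfl fun i _ => add_mul _ _ _)
  map_smul' g a := Subtype.ext (funext fun v => by
    change ∑ i, (g v.proj * a i v.proj) * ρ.incl v.proj v.2 i = g v.proj * ∑ i, a i v.proj * ρ.incl v.proj v.2 i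
    rw [Finset.mul_sum]
    exact Finset.sum_congr rfl fun i _ => mul_assoc _ _ _)

theorem ofCoef_apply (a : Fin m → SmoothFun EX X) (v : TotalSpace F₀ E₀) :
    (ρ.ofCoef a).1 v = ∑ i, a i v.proj * ρ.incl v.proj v.2 i := rfl

/-- Every vector `v` is the combination of the projected standard vectors with the coordinates of
`incl v`, and `φ` is linear on fibres. -/
theorem ofCoef_coef (φ : DualSec EX F₀ E₀) : ρ.ofCoef (ρ.coef φ) = φ := by
  refine Subtype.ext (funext fun v => ?_)
  have h : v.2 = ∑ i, ρ.incl v.proj v.2 i • ρ.proj v.proj (Pi.single i 1) := by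
    conv_lhs => rw [← ρ.proj_incl v.proj v.2, pi_eq_sum_univ' (ρ.incl v.proj v.2), map_sum]
    exact Finset.sum_congr rfl fun i _ => by
      rw [map_smul]
  rw [ofCoef_apply]
  change _ = φ.1 (TotalSpace.mk' F₀ v.proj v.2)
  conv_rhs => rw [h]
  rw [dualSec_sum]
  exact Finset.sum_congr rfl fun i _ => mul_comm _ _

theorem coef_ofCoef (a : Fin m → SmoothFun EX X) (i : Fin m) (x : X) :
    ρ.coef (ρ.ofCoef a) i x = ∑ j, a j x * ρ.incl x (ρ.proj x (Pi.single i 1)) j := rfl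

/-- The coordinates of `incl` are globally defined dual sections, and they already separate the
vectors of each fibre. -/
theorem eq_zero_of_dualSec (ρ : Retract EX F₀ E₀ m) (x : X) (v : E₀ x)
    (h : ∀ φ : DualSec EX F₀ E₀, φ.1 (TotalSpace.mk' F₀ x v) = 0) : v = 0 := by
  have h0 : ρ.incl x v = 0 := by
    funext i
    have := h (ρ.ofCoef (Pi.single i 1))
    rw [ofCoef_apply, Finset.sum_eq_single i (fun j _ hj => by simp [hj]) (by simp)] at this
    simpa using this
  rw [← ρ.proj_incl x v, h0, map_zero]

variable {C : Type*} [AddCommGroup C] [Module (SmoothFun EX X) C]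
  {f : (Fin m → SmoothFun EX X) →ₗ[SmoothFun EX X] C}
  {s : C →ₗ[SmoothFun EX X] (Fin m → SmoothFun EX X)}

open SmoothProjection in
/-- If `E₀` is the bundle of the transposed projections of `C`, the sections of its dual bundle are
`C`. -/
def dualEquiv (hfs : ∀ c, f (s c) = c)
    (h : ∀ x w, ρ.incl x (ρ.proj x w) = transposeAt f s x w) :
    DualSec EX F₀ E₀ ≃ₗ[SmoothFun EX X] C where
  toLinearMap := f ∘ₗ ρ.coef
  invFun c := ρ.ofCoef (s c)
  left_inv φ := by
    refine Subtype.ext (funext fun v => ?_)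
    conv_rhs => rw [← ρ.ofCoef_coef φ]
    -- Vectors of `E₀` are fixed by the transposed matrix, which absorbs the matrix of `s ∘ f`
    -- acting on coefficients.
    have h1 : ρ.incl v.proj v.2 = transposeAt f s v.proj (ρ.incl v.proj v.2) := by
      rw [← h, ρ.proj_incl]
    have h2 : ∀ i, s (f (ρ.coef φ)) i v.proj =
        ∑ j, ρ.coef φ j v.proj * s (f (Pi.single j 1)) i v.proj := by
      intro i
      have h3 : f (ρ.coef φ) = ∑ j, ρ.coef φ j • f (Pi.single j 1) := by
        conv_lhs => rw [← Finset.univ_sum_single (ρ.coef φ), map_sum]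
        refine Finset.sum_congr rfl fun j _ => ?_
        rw [← map_smul, ← Pi.single_smul, smul_eq_mul, mul_one]
      rw [h3]
      simp only [map_sum, map_smul, Finset.sum_apply, Pi.smul_apply, smul_eq_mul]
      exact map_sum (ContMDiffMap.evalRingHom (I := 𝓘(ℝ, EX)) (I' := 𝓘(ℝ, ℝ)) (n := ∞)
        (R := ℝ) v.proj) _ _
    change (ρ.ofCoef (s (f (ρ.coef φ)))).1 v = _
    rw [ofCoef_apply, ofCoef_apply]
    conv_rhs => rw [h1]
    simp only [transposeAt_apply, h2, Finset.sum_mul, Finset.mul_sum]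
    rw [Finset.sum_comm]
    exact Finset.sum_congr rfl fun i _ => Finset.sum_congr rfl fun j _ => mul_assoc _ _ _
  right_inv c := by
    change f (ρ.coef (ρ.ofCoef (s c))) = c
    conv_rhs => rw [← hfs c]
    congr 1
    funext i
    ext x
    rw [coef_ofCoef, ← sum_coeff_generators hfs c i x]
    refine Finset.sum_congr rfl fun j _ => ?_
    rw [h, transposeAt_apply, Finset.sum_eq_single i (fun k _ hk => by simp [hk]) (by simp)]
    simp

end Retract

end Retract

/-! ### Operators with values in the summand, and the Noether identities. -/

section Operators

variable {EX : Type*} [NormedAddCommGroup EX] [NormedSpace ℝ EX] [FiniteDimensional ℝ EX]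
  {EY : Type*} [NormedAddCommGroup EY] [NormedSpace ℝ EY]
  {X : Type*} [TopologicalSpace X] [ChartedSpace EX X] [IsManifold 𝓘(ℝ, EX) ∞ X]
  {Y : Type*} [TopologicalSpace Y] [ChartedSpace EY Y] [IsManifold 𝓘(ℝ, EY) ∞ Y]
  {F : Type*} [NormedAddCommGroup F] [NormedSpace ℝ F]
  {E : X → Type*} [TopologicalSpace (TotalSpace F E)] [∀ x, AddCommGroup (E x)]
  [∀ x, Module ℝ (E x)] [∀ x, TopologicalSpace (E x)] [FiberBundle F E]
  [VectorBundle ℝ F E] [ContMDiffVectorBundle ∞ F E 𝓘(ℝ, EX)]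
  {pr : Y → X}
  {F₀ : Type*} [NormedAddCommGroup F₀] [NormedSpace ℝ F₀]
  {E₀ : X → Type*} [TopologicalSpace (TotalSpace F₀ E₀)] [∀ x, AddCommGroup (E₀ x)]
  [∀ x, Module ℝ (E₀ x)] [∀ x, TopologicalSpace (E₀ x)] [FiberBundle F₀ E₀]
  [VectorBundle ℝ F₀ E₀] [ContMDiffVectorBundle ∞ F₀ E₀ 𝓘(ℝ, EX)] {m : ℕ}

/-- Finiteness of the family matters: all members must be functions of jets of one common order,
obtained by pairing step by step. -/
theorem jetSmooth_pi {Φ : Fin m → LinFun EX EY F E pr} :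
    JetSmooth EX (𝓘(ℝ, EY).prod (𝓘(ℝ, EX).prod 𝓘(ℝ, F))) 𝓘(ℝ, Fin m → ℝ) PairPoint.x PairPoint.map
      (fun p : PairPoint EX EY F E pr => fun i => (Φ i).1 p) := by
  induction m with
  | zero =>
    have : (fun p : PairPoint EX EY F E pr => fun i : Fin 0 => (Φ i).1 p) = fun _ => 0 :=
      funext fun p => Subsingleton.elim _ _
    rw [this]
    exact jetSmooth_const 0
  | succ m ih =>
    have h := ((Φ 0).2.1.prodMk (ih (Φ := fun i => Φ i.succ))).comp_contMDiff
      (JQ' := 𝓘(ℝ, Fin (m + 1) → ℝ))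
      (h := fun q : ℝ × (Fin m → ℝ) => (Fin.cons q.1 q.2 : Fin (m + 1) → ℝ)) (by
        refine contMDiff_pi_space.2 fun i => ?_
        refine Fin.cases ?_ (fun i => ?_) i
        · exact contMDiff_fst
        · exact contMDiff_pi_space.1 contMDiff_snd i)
    convert h using 1
    funext p i
    refine Fin.cases rfl (fun i => rfl) i

/-- The operator with values in `E₀` whose components are given by the functions `Φ`. -/
def Retract.toLinOp (ρ : Retract EX F₀ E₀ m) (Φ : Fin m → LinFun EX EY F E pr) :
    LinOp EX EY F E pr F₀ E₀ where
  toFun p := ρ.proj p.x fun i => (Φ i).1 p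
  smooth' := (jetSmooth_base.prodMk jetSmooth_pi).comp_contMDiff ρ.contMDiff_proj
  linear' j a b σ τ hσ hτ h := by
    rw [← map_smul, ← map_smul, ← map_add]
    congr 1
    funext i
    exact (Φ i).2.2 j a b σ τ hσ hτ h

open SmoothProjection in
theorem Retract.component_toLinOp (ρ : Retract EX F₀ E₀ m) {C : Type*} [AddCommGroup C]
    [Module (SmoothFun EX X) C] {f : (Fin m → SmoothFun EX X) →ₗ[SmoothFun EX X] C}
    {s : C →ₗ[SmoothFun EX X] (Fin m → SmoothFun EX X)} (hfs : ∀ c, f (s c) = c)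
    (h : ∀ x w, ρ.incl x (ρ.proj x w) = transposeAt f s x w)
    (rep : C →ₗ[SmoothFun EX X] LinFun EX EY F E pr) (φ : DualSec EX F₀ E₀) :
    (ρ.toLinOp fun i => rep (f (Pi.single i 1))).component φ = rep (ρ.dualEquiv hfs h φ) := by
  obtain ⟨c, rfl⟩ := (ρ.dualEquiv hfs h).symm.surjective φ
  rw [LinearEquiv.apply_symm_apply]
  refine Subtype.ext (funext fun p => ?_)
  have hval : ∀ (a : Fin m → SmoothFun EX X) (Φ : Fin m → LinFun EX EY F E pr),
      (∑ i, a i • Φ i).1 p = ∑ i, a i p.x * (Φ i).1 p := by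
    intro a Φ
    exact map_sum (⟨⟨fun Φ : LinFun EX EY F E pr => Φ.1 p, rfl⟩, fun _ _ => rfl⟩ :
      LinFun EX EY F E pr →+ ℝ) _ _
  have h1 : (rep c).1 p = ∑ j, s c j p.x * (rep (f (Pi.single j 1))).1 p := by
    conv_lhs => rw [← sum_smul_generators hfs c, map_sum]
    rw [← hval]
    simp only [map_smul]
  rw [h1]
  change ∑ i, s c i p.x * ρ.incl p.x (ρ.proj p.x fun i => (rep (f (Pi.single i 1))).1 p) i = _
  simp only [h, transposeAt_apply, Finset.mul_sum]
  rw [Finset.sum_comm]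
  refine Finset.sum_congr rfl fun j _ => ?_
  -- Projecting the tuple to `E₀` inserts the idempotent matrix, which the coefficients `s c`
  -- absorb.
  rw [← sum_coeff_generators hfs c j p.x, Finset.sum_mul]
  exact Finset.sum_congr rfl fun i _ => (mul_assoc _ _ _).symm

/-- A section of the dual bundle as a function of jets, independent of `Y` and of derivatives. -/
def DualSec.toLinFun (φ : DualSec EX F₀ E₀) : LinFun EX EY F₀ E₀ pr :=
  ⟨fun p => φ.1 (TotalSpace.mk' F₀ p.x (p.σ p.x)),
    (jetSmooth_value.comp_contMDiff (contMDiff_snd)).comp_contMDiff φ.2.1,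
    fun j a b σ τ _ _ _ => φ.2.2 j.x a b (σ j.x) (τ j.x)⟩

theorem LinOp.along_apply (Δ : LinOp EX EY F E pr F₀ E₀) (p : PairPoint EX EY F E pr) :
    Δ.along p.jet.s p.σ p.x = Δ.toFun p :=
  dif_pos (show IsLocalSection EX EY pr p.jet.s p.x ∧ IsSmoothNear EX F E p.σ p.x from
    ⟨p.jet.isSec, p.isSec⟩)

/-- A dual section sees only the value of the substituted section at the base point, not its
derivatives. -/
theorem LinOp.pull_toLinFun (Δ : LinOp EX EY F E pr F₀ E₀) (φ : DualSec EX F₀ E₀) :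
    Δ.pull φ.toLinFun = Δ.component φ :=
  Subtype.ext (funext fun p => congrArg (fun v => φ.1 (TotalSpace.mk' F₀ p.x v)) (Δ.along_apply p))

/-- The total derivatives of a component of `Δ` are substitutions of `Δ`. -/
theorem LinOp.pull_pull_toLinFun (Δ : LinOp EX EY F E pr F₀ E₀) (φ : DualSec EX F₀ E₀)
    (G : LinFun EX EY ℝ (Bundle.Trivial X ℝ) pr) :
    Δ.pull ((LinFun.toLinOp φ.toLinFun).pull G) = (LinFun.toLinOp (Δ.component φ)).pull G := by
  refine Subtype.ext (funext fun p => ?_)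
  -- Both sides evaluate `G` on the jet of a function near the base point. The two functions agree
  -- there as germs, being `φ` applied to `Δ` along the given sections.
  refine JetSmooth.congr_jet G.2.1 rfl ?_
  filter_upwards [p.jet.isSec.eventually_nhds, p.isSec.eventually_nhds,
    (Δ.push p).isSec.eventually_nhds] with y h1 h2 h3
  refine Prod.ext rfl (congrArg (TotalSpace.mk' ℝ y) ?_)
  have e1 := (LinFun.toLinOp (φ.toLinFun (EY := EY) (pr := pr))).along_apply
    ⟨⟨y, p.jet.s, h1⟩, Δ.along p.jet.s p.σ, h3⟩
  have e2 := (LinFun.toLinOp (Δ.component φ)).along_apply ⟨⟨y, p.jet.s, h1⟩, p.σ, h2⟩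
  have e3 := Δ.along_apply ⟨⟨y, p.jet.s, h1⟩, p.σ, h2⟩
  refine e1.trans (Eq.trans ?_ e2.symm)
  exact congrArg (fun v => φ.1 (TotalSpace.mk' F₀ y v)) e3

/-- The Noether identities say that the operator, substituted into the Koszul form, vanishes. -/
theorem noetherIdentities_iff (ℰ : DiffOp EX EY F E pr) (Δ : LinOp EX EY F E pr F₀ E₀)
    (hsep : ∀ (x : X) (v : E₀ x),
      (∀ φ : DualSec EX F₀ E₀, φ.1 (TotalSpace.mk' F₀ x v) = 0) → v = 0) :
    NoetherIdentities ℰ Δ ↔ ∀ G : LinFun EX EY F₀ E₀ pr, ℰ.koszulForm (Δ.pull G) = 0 := by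
  constructor
  · intro h G
    refine Subtype.ext (funext fun j => ?_)
    set p := Δ.push (ℰ.insert j) with hp
    -- The identities hold at all nearby jets of `s`, so the section vanishes as a germ, together
    -- with its derivatives.
    have hz : ∀ᶠ y in 𝓝 j.x, p.σ y = 0 := by
      filter_upwards [j.isSec.eventually_nhds, (ℰ.insert j).isSec.eventually_nhds] with y h1 h2
      exact (Δ.along_apply ⟨⟨y, j.s, h1⟩, (ℰ.insert j).σ, h2⟩).trans (h ⟨y, j.s, h1⟩)
    -- The zero section is written as a combination with zero coefficients, so that linearity of `G`
    -- gives the value zero.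
    have hs : IsSmoothNear EX F₀ E₀ ((0 : ℝ) • p.σ + (0 : ℝ) • p.σ) j.x := by
      filter_upwards [p.isSec, hz.eventually_nhds] with y h1 h2
      refine h1.congr_of_eventuallyEq ?_
      filter_upwards [h2] with z hz
      simp [hz]
    have h0 := G.2.2 j 0 0 p.σ p.σ p.isSec p.isSec hs
    rw [zero_mul, add_zero] at h0
    refine Eq.trans ?_ h0
    refine JetSmooth.congr_jet G.2.1 rfl ?_
    filter_upwards [hz] with y hy
    refine Prod.ext rfl (congrArg (TotalSpace.mk' F₀ y) ?_)
    change p.σ y = (0 : ℝ) • p.σ y + (0 : ℝ) • p.σ y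
    simp [hy]
  · intro h j
    -- Conversely, functions `G` of order zero suffice, because dual sections separate vectors.
    refine hsep _ _ fun φ => ?_
    have h1 := h φ.toLinFun
    rw [Δ.pull_toLinFun] at h1
    exact congrFun (congrArg Subtype.val h1) j

theorem koszul_ι (ℰ : DiffOp EX EY F E pr) (Φ : LinFun EX EY F E pr) :
    koszul ℰ (ExteriorAlgebra.ι _ Φ) = algebraMap _ _ (ℰ.koszulForm Φ) :=
  CliffordAlgebra.contractRight_ι _ _ Φ

theorem mem_cycles_iff (ℰ : DiffOp EX EY F E pr) (Φ : LinFun EX EY F E pr) :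
    Φ ∈ cycles ℰ ↔ ℰ.koszulForm Φ = 0 := by
  rw [cycles, LinearMap.mem_ker, LinearMap.comp_apply, koszul_ι]
  exact ExteriorAlgebra.algebraMap_eq_zero_iff _ _

end Operators

end NoetherKT
end

noncomputable section
namespace NoetherKT

/-! ### The Koszul–Tate differential and one-exactness. -/

section KoszulTate

variable {EX : Type*} [NormedAddCommGroup EX] [NormedSpace ℝ EX] [FiniteDimensional ℝ EX]
  {EY : Type*} [NormedAddCommGroup EY] [NormedSpace ℝ EY]
  {X : Type*} [TopologicalSpace X] [ChartedSpace EX X] [IsManifold 𝓘(ℝ, EX) ∞ X]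
  {Y : Type*} [TopologicalSpace Y] [ChartedSpace EY Y] [IsManifold 𝓘(ℝ, EY) ∞ Y]
  {F : Type*} [NormedAddCommGroup F] [NormedSpace ℝ F]
  {E : X → Type*} [TopologicalSpace (TotalSpace F E)] [∀ x, AddCommGroup (E x)]
  [∀ x, Module ℝ (E x)] [∀ x, TopologicalSpace (E x)] [FiberBundle F E]
  [VectorBundle ℝ F E] [ContMDiffVectorBundle ∞ F E 𝓘(ℝ, EX)]
  {pr : Y → X}
  {F₀ : Type*} [NormedAddCommGroup F₀] [NormedSpace ℝ F₀]
  {E₀ : X → Type*} [TopologicalSpace (TotalSpace F₀ E₀)] [∀ x, AddCommGroup (E₀ x)]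
  [∀ x, Module ℝ (E₀ x)] [∀ x, TopologicalSpace (E₀ x)] [FiberBundle F₀ E₀]
  [VectorBundle ℝ F₀ E₀] [ContMDiffVectorBundle ∞ F₀ E₀ 𝓘(ℝ, EX)]

/-- The Koszul–Tate differential `δ + ∂_r Δ^r`. -/
def koszulTate (ℰ : DiffOp EX EY F E pr) (Δ : LinOp EX EY F E pr F₀ E₀) :
    extRing EX EY F E pr F₀ E₀ →ₗ[JetFun EX EY pr] extRing EX EY F E pr F₀ E₀ :=
  KoszulTate.derivation ℰ.koszulForm Δ.pull

theorem isGradedDerivation_koszulTate (ℰ : DiffOp EX EY F E pr) (Δ : LinOp EX EY F E pr F₀ E₀) :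
    KoszulTate.IsGradedDerivation (oddGen EX EY F E pr F₀ E₀) (evenGen EX EY F E pr F₀ E₀)
      ℰ.koszulForm Δ.pull (koszulTate ℰ Δ) :=
  KoszulTate.isGradedDerivation_derivation _ _

theorem isKoszulTate_koszulTate (ℰ : DiffOp EX EY F E pr) (Δ : LinOp EX EY F E pr F₀ E₀) :
    IsKoszulTate ℰ Δ (koszulTate ℰ Δ) where
  map_mul := (isGradedDerivation_koszulTate ℰ Δ).leibniz
  map_odd := (isGradedDerivation_koszulTate ℰ Δ).map_odd
  map_even := (isGradedDerivation_koszulTate ℰ Δ).map_even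

theorem IsKoszulTate.eq_koszulTate {ℰ : DiffOp EX EY F E pr} {Δ : LinOp EX EY F E pr F₀ E₀}
    {D : extRing EX EY F E pr F₀ E₀ →ₗ[JetFun EX EY pr] extRing EX EY F E pr F₀ E₀}
    (h : IsKoszulTate ℰ Δ D) : D = koszulTate ℰ Δ :=
  (isGradedDerivation_koszulTate ℰ Δ).unique KoszulTate.eq_top_of_generators
    (KoszulTate.IsGradedDerivation.of_leibniz h.map_mul h.map_odd h.map_even)

theorem koszulTate_nilpotent_iff (ℰ : DiffOp EX EY F E pr) (Δ : LinOp EX EY F E pr F₀ E₀)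
    (hsep : ∀ (x : X) (v : E₀ x),
      (∀ φ : DualSec EX F₀ E₀, φ.1 (TotalSpace.mk' F₀ x v) = 0) → v = 0) :
    (∀ f, koszulTate ℰ Δ (koszulTate ℰ Δ f) = 0) ↔ NoetherIdentities ℰ Δ := by
  rw [noetherIdentities_iff ℰ Δ hsep]
  exact (isGradedDerivation_koszulTate ℰ Δ).comp_self_eq_zero_iff KoszulTate.eq_top_of_generators
    KoszulTate.algebraMap_injective

theorem koszulTate_inclS (ℰ : DiffOp EX EY F E pr) (Δ : LinOp EX EY F E pr F₀ E₀)
    (a : gradedRing EX EY F E pr) :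
    koszulTate ℰ Δ (inclS EX EY F E pr F₀ E₀ a) = inclS EX EY F E pr F₀ E₀ (koszul ℰ a) :=
  KoszulTate.derivation_tmul_one _ _ a

/-- The `k`-th exterior power is the `k`-th power of the range of the odd generators, and algebra
homomorphisms preserve powers of submodules. -/
theorem map_inclS_pow_le_antifield (k : ℕ) : (⋀[JetFun EX EY pr]^k (LinFun EX EY F E pr)).map
    (inclS EX EY F E pr F₀ E₀).toLinearMap ≤ antifield EX EY F E pr F₀ E₀ k := by
  have h := Submodule.map_pow (LinearMap.range (ExteriorAlgebra.ι (JetFun EX EY pr)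
    (M := LinFun EX EY F E pr))) (inclS EX EY F E pr F₀ E₀) k
  rw [← LinearMap.range_comp] at h
  exact h.le.trans (KoszulTate.pow_range_le_degree (oddGen EX EY F E pr F₀ E₀)
    (evenGen EX EY F E pr F₀ E₀) k)

theorem chain_one (ℰ : DiffOp EX EY F E pr) :
    chain F₀ E₀ ℰ 1 = LinearMap.range (oddGen EX EY F E pr F₀ E₀) := by
  change Submodule.map _ (LinearMap.range (ExteriorAlgebra.ι (JetFun EX EY pr)) ^ 1) = _
  rw [pow_one, ← LinearMap.range_comp]
  rfl

theorem antifield_one : antifield EX EY F E pr F₀ E₀ 1 =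
    LinearMap.range (oddGen EX EY F E pr F₀ E₀) :=
  KoszulTate.degree_one (oddGen EX EY F E pr F₀ E₀) (evenGen EX EY F E pr F₀ E₀)

theorem koszulTate_mem_antifield (ℰ : DiffOp EX EY F E pr) (Δ : LinOp EX EY F E pr F₀ E₀) (k : ℕ)
    {f : extRing EX EY F E pr F₀ E₀} (hf : f ∈ antifield EX EY F E pr F₀ E₀ (k + 1)) :
    koszulTate ℰ Δ f ∈ antifield EX EY F E pr F₀ E₀ k :=
  (isGradedDerivation_koszulTate ℰ Δ).map_degree KoszulTate.odd_commute_even k hf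

theorem extendsKoszul_koszulTate (ℰ : DiffOp EX EY F E pr) (Δ : LinOp EX EY F E pr F₀ E₀) :
    ExtendsKoszul ℰ (koszulTate ℰ Δ) where
  injective := KoszulTate.includeLeft_injective
  le_antifield := map_inclS_pow_le_antifield
  antifield_one := antifield_one.trans (chain_one ℰ).symm
  comm := koszulTate_inclS ℰ Δ

/-- The one-exactness: it holds as soon as every cycle is homologous to a substitution of `Δ`. -/
theorem isOneExactComplex_koszulTate (ℰ : DiffOp EX EY F E pr) (Δ : LinOp EX EY F E pr F₀ E₀)
    (hnil : ∀ f, koszulTate ℰ Δ (koszulTate ℰ Δ f) = 0)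
    (hcyc : ∀ Φ ∈ cycles ℰ, ∃ G : LinFun EX EY F₀ E₀ pr, Φ - Δ.pull G ∈ boundaries ℰ) :
    IsOneExactComplex ℰ (koszulTate ℰ Δ) where
  map_chain k Φ hΦ := by
    match k with
    | 0 =>
      rw [chain_one] at hΦ
      obtain ⟨Ψ, rfl⟩ := hΦ
      rw [(isGradedDerivation_koszulTate ℰ Δ).map_odd]
      exact ⟨_, ⟨Ψ, rfl⟩, rfl⟩
    | 1 =>
      rw [chain_one, ← antifield_one]
      exact koszulTate_mem_antifield ℰ Δ 1 hΦ
    | 2 => exact koszulTate_mem_antifield ℰ Δ 2 hΦ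
    | k + 3 =>
      have h0 : Φ = 0 := hΦ
      rw [h0, map_zero]
      exact zero_mem _
  comp_zero k Φ _ := hnil Φ
  exact_zero Φ hΦ := by
    obtain ⟨_, ⟨Ψ, rfl⟩, rfl⟩ := hΦ
    exact ⟨oddGen EX EY F E pr F₀ E₀ Ψ, by rw [chain_one]; exact ⟨Ψ, rfl⟩,
      (isGradedDerivation_koszulTate ℰ Δ).map_odd Ψ⟩
  exact_one Φ hΦ h := by
    rw [chain_one] at hΦ
    obtain ⟨Φ, rfl⟩ := hΦ
    have hΦ : Φ ∈ cycles ℰ := by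
      rw [mem_cycles_iff]
      rw [(isGradedDerivation_koszulTate ℰ Δ).map_odd] at h
      exact KoszulTate.algebraMap_injective (h.trans (map_zero _).symm)
    obtain ⟨G, a, ha, hG⟩ := hcyc Φ hΦ
    -- The odd quadratic element `a` produces the boundary `Φ - Δ.pull G`, and the even generator
    -- supplies the missing `Δ.pull G`.
    refine ⟨inclS EX EY F E pr F₀ E₀ a + evenGen EX EY F E pr F₀ E₀ G,
      add_mem (map_inclS_pow_le_antifield 2 ⟨a, ha, rfl⟩)
        (KoszulTate.range_even_le_degree (oddGen EX EY F E pr F₀ E₀) _ ⟨G, rfl⟩), ?_⟩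
    rw [map_add, koszulTate_inclS, hG, (isGradedDerivation_koszulTate ℰ Δ).map_even]
    change oddGen EX EY F E pr F₀ E₀ (Φ - Δ.pull G) + oddGen EX EY F E pr F₀ E₀ (Δ.pull G) = _
    rw [← map_add, sub_add_cancel]

end KoszulTate

/-- The retract given by the bundle of a family of projections. -/
def _root_.SmoothProjection.Family.retract {EX : Type*} [NormedAddCommGroup EX] [NormedSpace ℝ EX]
    {X : Type*} [TopologicalSpace X] [ChartedSpace EX X] {m n : ℕ}
    (T : SmoothProjection.Family EX X (Fin m → ℝ) n) :
    Retract EX (EuclideanSpace ℝ (Fin n)) T.core.Fiber m where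
  incl := T.incl
  proj := T.proj
  proj_incl := T.proj_incl
  contMDiff_incl := T.contMDiff_incl
  contMDiff_proj := T.contMDiff_proj

end NoetherKT
end

/-! ### The theorem. -/

open NoetherKT
theorem proposition3
    {EX : Type*} [NormedAddCommGroup EX] [NormedSpace ℝ EX] [FiniteDimensional ℝ EX]
    {X : Type*} [TopologicalSpace X] [T2Space X] [SecondCountableTopology X]
    [ChartedSpace EX X] [IsManifold 𝓘(ℝ, EX) ∞ X]
    {EY : Type*} [NormedAddCommGroup EY] [NormedSpace ℝ EY] [FiniteDimensional ℝ EY]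
    {Y : Type*} [TopologicalSpace Y] [T2Space Y] [SecondCountableTopology Y]
    [ChartedSpace EY Y] [IsManifold 𝓘(ℝ, EY) ∞ Y]
    {EN : Type*} [NormedAddCommGroup EN] [NormedSpace ℝ EN] [FiniteDimensional ℝ EN]
    {N : Type*} [TopologicalSpace N] [ChartedSpace EN N] [IsManifold 𝓘(ℝ, EN) ∞ N]
    (pr : Y → X) (hpr : IsSmoothFiberBundle EX EY EN N pr)
    {F : Type*} [NormedAddCommGroup F] [NormedSpace ℝ F] [FiniteDimensional ℝ F]
    {E : X → Type*} [TopologicalSpace (TotalSpace F E)] [∀ x, AddCommGroup (E x)]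
    [∀ x, Module ℝ (E x)] [∀ x, TopologicalSpace (E x)] [FiberBundle F E]
    [VectorBundle ℝ F E] [ContMDiffVectorBundle ∞ F E 𝓘(ℝ, EX)]
    (ℰ : DiffOp EX EY F E pr)
    (C : Submodule (SmoothFun EX X) (H1 ℰ)) (hC : IsNoetherModule ℰ C) :
    ∃ (n : ℕ) (E₀ : X → Type)
      (_ : TopologicalSpace (TotalSpace (EuclideanSpace ℝ (Fin n)) E₀))
      (_ : ∀ x, AddCommGroup (E₀ x)) (_ : ∀ x, Module ℝ (E₀ x))
      (_ : ∀ x, TopologicalSpace (E₀ x)) (_ : FiberBundle (EuclideanSpace ℝ (Fin n)) E₀)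
      (_ : VectorBundle ℝ (EuclideanSpace ℝ (Fin n)) E₀)
      (_ : ContMDiffVectorBundle ∞ (EuclideanSpace ℝ (Fin n)) E₀ 𝓘(ℝ, EX))
      (Δ : LinOp EX EY F E pr (EuclideanSpace ℝ (Fin n)) E₀),
      (∃ e : DualSec EX (EuclideanSpace ℝ (Fin n)) E₀ ≃ₗ[SmoothFun EX X] C,
        ∀ φ, ∃ h : Δ.component φ ∈ cycles ℰ,
          (e φ : H1 ℰ) = Submodule.Quotient.mk ⟨Δ.component φ, h⟩) ∧
      (∀ Δ' : LinOp EX EY F E pr (EuclideanSpace ℝ (Fin n)) E₀,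
        ∃ D, IsKoszulTate ℰ Δ' D ∧ (∀ D', IsKoszulTate ℰ Δ' D' → D' = D) ∧
          ((∀ f, D (D f) = 0) ↔ NoetherIdentities ℰ Δ')) ∧
      ∃ D, IsKoszulTate ℰ Δ D ∧ (∀ f, D (D f) = 0) ∧ ExtendsKoszul ℰ D ∧
        IsOneExactComplex ℰ D := by
  have := hC.finite
  have := hC.projective
  obtain ⟨n, hn⟩ := hC.rank
  obtain ⟨rep, hrep, hspan⟩ := hC.factorizes
  obtain ⟨m, f, hf⟩ := Module.Finite.exists_fin' (SmoothFun EX X) C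
  -- Projectivity splits the surjection `f`; the idempotent `s ∘ f` then determines `E₀`.
  obtain ⟨s, hs⟩ := Module.projective_lifting_property f LinearMap.id hf
  have hfs : ∀ c, f (s c) = c := fun c => congrArg (fun g => g c) hs
  let T := SmoothProjection.ofModule hn hfs
  let ρ := T.retract
  have hρ : ∀ x w, ρ.incl x (ρ.proj x w) = SmoothProjection.transposeAt f s x w := T.incl_proj
  let rep' : C →ₗ[SmoothFun EX X] LinFun EX EY F E pr :=
    ((cycles ℰ).subtype.restrictScalars (SmoothFun EX X)).comp rep
  -- The tuple of chosen representatives of the generators of `C`, projected to `E₀`.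
  let Δ := ρ.toLinOp fun i => rep' (f (Pi.single i 1))
  have hΔ : ∀ φ, Δ.component φ = rep (ρ.dualEquiv hfs hρ φ) :=
    fun φ => ρ.component_toLinOp hfs hρ rep' φ
  have hmem : ∀ φ, Δ.component φ ∈ cycles ℰ := fun φ => by rw [hΔ]; exact Subtype.property _
  -- All components of `Δ` are cycles, so every dual section vanishes on `Δ(s, ℰ(s))`.
  have hN : NoetherIdentities ℰ Δ := fun j => ρ.eq_zero_of_dualSec _ _ fun φ =>
    congrFun (congrArg Subtype.val ((mem_cycles_iff ℰ _).1 (hmem φ))) j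
  have hnil := (koszulTate_nilpotent_iff ℰ Δ ρ.eq_zero_of_dualSec).2 hN
  refine ⟨n, T.core.Fiber, inferInstance, inferInstance, inferInstance, inferInstance,
    inferInstance, inferInstance, inferInstance, Δ, ⟨ρ.dualEquiv hfs hρ, fun φ => ⟨hmem φ, ?_⟩⟩,
    fun Δ' => ⟨koszulTate ℰ Δ', isKoszulTate_koszulTate ℰ Δ', fun _ h => h.eq_koszulTate,
      koszulTate_nilpotent_iff ℰ Δ' ρ.eq_zero_of_dualSec⟩,
    koszulTate ℰ Δ, isKoszulTate_koszulTate ℰ Δ, hnil, extendsKoszul_koszulTate ℰ Δ,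
    isOneExactComplex_koszulTate ℰ Δ hnil fun Φ hΦ => ?_⟩
  · rw [← hrep]
    exact congrArg _ (Subtype.ext (hΔ φ).symm)
  · obtain ⟨Ψ, hΨ, hb⟩ := hspan Φ hΦ
    -- The range of `Δ.pull` is a submodule over `O_∞ Y`, so it is enough to treat one element `c`
    -- of `C`; its representative is a component of `Δ`, and its total derivatives are again
    -- substitutions of `Δ`.
    have hle : Submodule.span (JetFun EX EY pr)
        {Θ : LinFun EX EY F E pr | ∃ (c : C) (G : LinFun EX EY ℝ (Bundle.Trivial X ℝ) pr),
          Θ = (LinFun.toLinOp (rep c : LinFun EX EY F E pr)).pull G} ≤ LinearMap.range Δ.pull := by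
      rw [Submodule.span_le]
      rintro _ ⟨c, G, rfl⟩
      obtain ⟨φ, rfl⟩ := (ρ.dualEquiv hfs hρ).surjective c
      exact ⟨(LinFun.toLinOp φ.toLinFun).pull G, by rw [Δ.pull_pull_toLinFun, hΔ]⟩
    obtain ⟨G, rfl⟩ := hle hΨ
    exact ⟨G, hb⟩
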